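/- There is an absolute constant $n_0$ such that the following holds for every $n \ge n_0$ and every real $d$ with $12 \le d \le e^{\sqrt[3]{\log n}}$ (where $\log$ is the natural logarithm). Let $G=(V,E)$ be a finite simple graph on $n$ vertices, and for $S \subseteq V$ let $N(S)=\{v\in V\setminus S : \exists u\in S,\ uv\in E\}$ denote its external neighborhood. Suppose that (P1) for every $S \subseteq V$ with $|S| \le \frac{n \log\log n \log d}{d \log n \log\log\log n}$ we have $|N(S)| \ge d|S|$; (P2) there is an edge of $G$ between any two disjoint subsets $A,B\subseteq V$ with $|A|,|B| \ge \frac{n \log\log n \log d}{4130 \log n \log\log\log n}$. Then $G$ is Hamilton-connected, that is, for every two distinct vertices $u,v\in V$ there is a Hamilton path of $G$ from $u$ to $v$. In particular, every edge of $G$ lies on some Hamilton cycle of $G$. -/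

import Mathlib

namespace SimpleGraph

/-- The external neighborhood `N(S) = {v ∈ V \ S : ∃ u ∈ S, uv ∈ E}`. -/
noncomputable def externalNeighborhood {V : Type*} [Fintype V] (G : SimpleGraph V)
    (S : Finset V) : Finset V :=
  open Classical in Finset.univ.filter (fun v => v ∉ S ∧ ∃ u ∈ S, G.Adj u v)

/-- Property P1 with parameter `d`, where `n` is the number of vertices:
every `S ⊆ V` with `|S| ≤ n log log n log d / (d log n log log log n)`
satisfies `|N(S)| ≥ d |S|`. -/
def PropertyP1 {V : Type*} [Fintype V] (G : SimpleGraph V) (d : ℝ) : Prop :=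
  let n : ℝ := (Fintype.card V : ℝ)
  ∀ S : Finset V,
    (S.card : ℝ) ≤ (n * Real.log (Real.log n) * Real.log d) /
        (d * Real.log n * Real.log (Real.log (Real.log n))) →
      d * (S.card : ℝ) ≤ ((G.externalNeighborhood S).card : ℝ)

/-- Property P2 with parameter `d`, where `n` is the number of vertices:
there is an edge between any two disjoint `A, B ⊆ V` with
`|A|, |B| ≥ n log log n log d / (4130 log n log log log n)`. -/
def PropertyP2 {V : Type*} [Fintype V] (G : SimpleGraph V) (d : ℝ) : Prop :=
  let n : ℝ := (Fintype.card V : ℝ)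
  ∀ A B : Finset V, Disjoint A B →
    (n * Real.log (Real.log n) * Real.log d) /
        (4130 * Real.log n * Real.log (Real.log (Real.log n))) ≤ (A.card : ℝ) →
    (n * Real.log (Real.log n) * Real.log d) /
        (4130 * Real.log n * Real.log (Real.log (Real.log n))) ≤ (B.card : ℝ) →
      ∃ a ∈ A, ∃ b ∈ B, G.Adj a b

/-- `G` is Hamilton-connected: any two distinct vertices are the ends of a Hamilton path.
(A path has distinct ends as soon as it has an edge, hence `u ≠ v`.) -/
def IsHamiltonConnected {V : Type*} [DecidableEq V] (G : SimpleGraph V) : Prop :=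
  ∀ u v : V, u ≠ v → ∃ p : G.Walk u v, p.IsHamiltonian

end SimpleGraph

/-! Fix u ≠ v, let R be G with the edge uv added, and take a longest path of R through uv. It
suffices to rearrange it, keeping uv, into a path whose ends are adjacent in G. Removing uv from the
resulting cycle then leaves a path of G between u and v (`exists_chain_of_closed`), and if that path
missed a vertex, connectedness of G (`ExpandsUpTo.exists_adj_boundary`) would give a longer path of
R through uv (`exists_longer`).

The closing edge comes from two stages of Pósa rotations. Neighbours of an end of a longest path
stay on the path, so P1 multiplies the set of attainable first vertices by about d/4 per rotation.
After at most K + 2 rotations, K being about 3 log n / log d, P2 brings this set to a third of all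
vertices (`exists_many_rearrangements`). Working at both ends yields n²/9 pairs of ends, each
realised at the cost of at most 2(K + 2) edges (`exists_many_pairs`).

P2 alone cannot close one of these paths, since the attainable pairs need not form a product of two
large sets. So the original path is divided into 4(K + 2) segments. Every rearrangement keeps at
least half of them, and can be cut into two parts containing K + 2 whole segments each
(`exists_cut`). By averaging, a 36^(-h) share of the pairs has the same h segments on the left and
the same h segments on the right (`exists_common_subset`), with h about log log n / log log log n.
Each of these two families is so large that P2 supplies a set whose small subsets expand into its
inner vertices (`exists_expanding_set`), and this set does not depend on the pair. For a pair whose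
two ends are adjacent to such inner vertices, rotations within the two parts give more than t new
ends on each side independently (`exists_many_heads`), and P2 joins two of them.

The bound on d makes 36^h t small compared with n, so that enough pairs survive the averaging. -/

namespace SimpleGraph

variable {V : Type*}

/-! ### Edges of a path given as a list. -/

/-- The list of unordered pairs of consecutive elements of a list. -/
def linkEdges : List V → List (Sym2 V)
  | a :: b :: l => s(a, b) :: linkEdges (b :: l)
  | _ => []

@[simp] lemma linkEdges_nil : linkEdges ([] : List V) = [] := rfl

@[simp] lemma linkEdges_singleton (a : V) : linkEdges [a] = [] := rfl

@[simp] lemma linkEdges_cons_cons (a b : V) (l : List V) :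
    linkEdges (a :: b :: l) = s(a, b) :: linkEdges (b :: l) := rfl

lemma linkEdges_append (A Q : List V) (z y : V) :
    linkEdges (A ++ z :: y :: Q) = linkEdges (A ++ [z]) ++ s(z, y) :: linkEdges (y :: Q) := by
  induction A with
  | nil => simp
  | cons a A ih => cases A <;> simp_all

lemma linkEdges_reverse (l : List V) : linkEdges l.reverse = (linkEdges l).reverse := by
  induction l with
  | nil => rfl
  | cons a l ih =>
    cases l with
    | nil => rfl
    | cons b l =>
      have : (a :: b :: l).reverse = l.reverse ++ b :: a :: [] := by simp
      rw [this, linkEdges_append]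
      simp only [List.reverse_cons] at ih
      rw [ih]
      simp [Sym2.eq_swap]

lemma mem_of_mem_linkEdges {l : List V} {e : Sym2 V} {a : V} (he : e ∈ linkEdges l)
    (ha : a ∈ e) : a ∈ l := by
  induction l with
  | nil => simp at he
  | cons b l ih =>
    cases l with
    | nil => simp at he
    | cons c l =>
      simp only [linkEdges_cons_cons, List.mem_cons] at he
      rcases he with rfl | he
      · simp only [Sym2.mem_iff] at ha
        rcases ha with rfl | rfl <;> simp
      · exact List.mem_cons_of_mem _ (ih he)

lemma linkEdges_append_subset_left (A B : List V) : linkEdges A ⊆ linkEdges (A ++ B) := by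
  induction A with
  | nil => simp
  | cons a A ih =>
    cases A with
    | nil => simp
    | cons b A =>
      simp only [linkEdges_cons_cons, List.cons_append]
      exact List.cons_subset_cons _ ih

lemma linkEdges_append_subset_right (A B : List V) : linkEdges B ⊆ linkEdges (A ++ B) := by
  induction A with
  | nil => simp
  | cons a A ih =>
    cases h : A ++ B with
    | nil => simp_all
    | cons b C =>
      rw [h] at ih
      rw [List.cons_append, h, linkEdges_cons_cons]
      exact fun e he => List.mem_cons_of_mem _ (ih he)

lemma mem_linkEdges_append {A B : List V} {e : Sym2 V} (he : e ∈ linkEdges (A ++ B)) :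
    e ∈ linkEdges A ∨ e ∈ linkEdges B ∨ ∃ a ∈ A, ∃ b ∈ B, e = s(a, b) := by
  rcases List.eq_nil_or_concat A with rfl | ⟨A', z, rfl⟩
  · simp_all
  cases B with
  | nil => simp_all
  | cons y Q =>
    rw [List.concat_eq_append, List.append_assoc, List.singleton_append, linkEdges_append] at he
    simp only [List.mem_append, List.mem_cons] at he
    rcases he with he | rfl | he
    · left; simpa using he
    · right; right; exact ⟨z, by simp, y, by simp, rfl⟩
    · right; left; exact he

lemma exists_eq_append_of_mem_linkEdges {l : List V} {e : Sym2 V} (he : e ∈ linkEdges l) :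
    ∃ A z y Q, l = A ++ z :: y :: Q ∧ e = s(z, y) := by
  induction l with
  | nil => simp at he
  | cons b l ih =>
    cases l with
    | nil => simp at he
    | cons c l =>
      simp only [linkEdges_cons_cons, List.mem_cons] at he
      rcases he with rfl | he
      · exact ⟨[], b, c, l, rfl, rfl⟩
      · obtain ⟨A, z, y, Q, h, h'⟩ := ih he
        exact ⟨b :: A, z, y, Q, by rw [h]; rfl, h'⟩

lemma mem_linkEdges_getElem (l : List V) (i : ℕ) (h : i + 1 < l.length) :
    s(l[i], l[i + 1]) ∈ linkEdges l := by
  have : l = l.take i ++ l[i] :: l[i + 1] :: l.drop (i + 2) := by simp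
  generalize l[i] = a at *
  generalize l[i + 1] = b at *
  rw [this, linkEdges_append]
  simp

lemma eq_or_eq_of_mem_linkEdges {A Q : List V} {w z y : V} (hn : (A ++ z :: y :: Q).Nodup)
    (h : s(w, y) ∈ linkEdges (A ++ z :: y :: Q)) : w = z ∨ Q.head? = some w := by
  rw [linkEdges_append] at h
  have hy : y ∉ A ++ [z] := by
    have : A ++ z :: y :: Q = (A ++ [z]) ++ y :: Q := by simp
    rw [this, List.nodup_append] at hn
    intro hy
    exact hn.2.2 y hy y (by simp) rfl
  have hyQ : y ∉ Q := by
    have : A ++ z :: y :: Q = (A ++ [z]) ++ y :: Q := by simp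
    rw [this, List.nodup_append] at hn
    exact (List.nodup_cons.1 hn.2.1).1
  simp only [List.mem_append, List.mem_cons] at h
  rcases h with h | h | h
  · exact absurd (mem_of_mem_linkEdges h (by simp)) hy
  · left; aesop
  · right
    cases Q with
    | nil => simp at h
    | cons q Q =>
      simp only [linkEdges_cons_cons, List.mem_cons] at h
      rcases h with h | h
      · simp at h hyQ
        aesop
      · exact absurd (mem_of_mem_linkEdges h (by simp)) hyQ

lemma eq_of_mem_linkEdges_cons {Q : List V} {w y : V} (hn : (y :: Q).Nodup)
    (h : s(w, y) ∈ linkEdges (y :: Q)) : Q.head? = some w := by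
  cases Q with
  | nil => simp at h
  | cons q Q =>
    simp only [linkEdges_cons_cons, List.mem_cons] at h
    rcases h with h | h
    · simp at h hn
      aesop
    · exact absurd (mem_of_mem_linkEdges h (by simp)) (List.nodup_cons.1 hn).1

lemma mem_linkEdges_left {L R : List V} {a b : V} (hn : (L ++ R).Nodup)
    (h : s(a, b) ∈ linkEdges (L ++ R)) (ha : a ∈ L) (hb : b ∈ L) : s(a, b) ∈ linkEdges L := by
  have hd := (List.nodup_append.1 hn).2.2
  rcases mem_linkEdges_append h with h | h | ⟨c, hc, d, hdd, h⟩
  · exact h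
  · exact absurd rfl (hd a ha a (mem_of_mem_linkEdges h (by simp)))
  · rcases Sym2.eq_iff.1 h with ⟨rfl, rfl⟩ | ⟨rfl, rfl⟩
    · exact absurd rfl (hd _ hb _ hdd)
    · exact absurd rfl (hd _ ha _ hdd)

lemma mem_linkEdges_right {L R : List V} {a b : V} (hn : (L ++ R).Nodup)
    (h : s(a, b) ∈ linkEdges (L ++ R)) (ha : a ∈ R) (hb : b ∈ R) : s(a, b) ∈ linkEdges R := by
  have := mem_linkEdges_left (L := R.reverse) (R := L.reverse) (a := a) (b := b)
    (by rw [← List.reverse_append]; exact List.nodup_reverse.2 hn)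
    (by rw [← List.reverse_append, linkEdges_reverse]; simpa using h) (by simpa) (by simpa)
  simpa [linkEdges_reverse] using this

/-! ### Pósa rotations and the edges they lose. -/

/-- Rotating a path at an inner vertex `y` adjacent to its first vertex `x`: the new first vertex is
one of the two neighbours of `y` on the path, and only the edge between them is lost. -/
lemma exists_rotation {G R : SimpleGraph V} (hGR : G ≤ R) {l : List V} {x y w₁ w₂ : V}
    (hc : l.IsChain R.Adj) (hn : l.Nodup) (hx : l.head? = some x) (hxy : G.Adj x y)
    (hw : w₁ ≠ w₂) (h₁ : s(w₁, y) ∈ linkEdges l) (h₂ : s(w₂, y) ∈ linkEdges l) :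
    ∃ z, (z = w₁ ∨ z = w₂) ∧ ∃ l' : List V, l'.Perm l ∧ l'.IsChain R.Adj ∧
      l'.getLast? = l.getLast? ∧ l'.head? = some z ∧
      ∀ e ∈ linkEdges l, e ≠ s(z, y) → e ∈ linkEdges l' := by
  obtain ⟨A', Q, rfl⟩ := List.append_of_mem (mem_of_mem_linkEdges h₁ (Sym2.mem_mk_right w₁ y))
  -- In first position y would have only one neighbour on the path. So it has a predecessor z, and
  -- the prefix ending at z gets reversed.
  rcases List.eq_nil_or_concat A' with rfl | ⟨A, z, rfl⟩
  · have e₁ := eq_of_mem_linkEdges_cons (by simpa using hn) (by simpa using h₁)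
    have e₂ := eq_of_mem_linkEdges_cons (by simpa using hn) (by simpa using h₂)
    rw [e₁] at e₂
    exact absurd (Option.some.inj e₂) hw
  have hA : A.concat z ++ y :: Q = A ++ z :: y :: Q := by simp
  rw [hA] at hc hn hx h₁ h₂ ⊢
  have hz : z = w₁ ∨ z = w₂ := by
    rcases eq_or_eq_of_mem_linkEdges hn h₁ with h | e₁
    · exact Or.inl h.symm
    rcases eq_or_eq_of_mem_linkEdges hn h₂ with h | e₂
    · exact Or.inr h.symm
    rw [e₁] at e₂
    exact absurd (Option.some.inj e₂) hw
  refine ⟨z, hz, (A ++ [z]).reverse ++ y :: Q, ?_, ?_, ?_, ?_, ?_⟩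
  · have : A ++ z :: y :: Q = (A ++ [z]) ++ y :: Q := by simp
    rw [this]
    exact List.Perm.append_right _ (List.reverse_perm _)
  · have : A ++ z :: y :: Q = (A ++ [z]) ++ y :: Q := by simp
    rw [this, List.isChain_append] at hc
    rw [List.isChain_append]
    refine ⟨?_, hc.2.1, ?_⟩
    · rw [List.isChain_reverse]
      simpa only [R.adj_comm] using hc.1
    · intro a ha b hb
      rw [List.getLast?_reverse] at ha
      have : a = x := by
        have h3 : (A ++ z :: y :: Q).head? = (A ++ [z]).head? := by cases A <;> simp
        rw [h3, Option.mem_def.1 ha] at hx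
        exact Option.some.inj hx
      simp at hb
      subst this hb
      exact hGR hxy
  · simp [List.getLast?_append, List.getLast?_cons]
  · simp
  · intro e he hne
    rw [linkEdges_append] at he
    simp only [List.mem_append, List.mem_cons] at he
    rcases he with he | he | he
    · apply linkEdges_append_subset_left
      rw [linkEdges_reverse]
      simpa using he
    · exact absurd he hne
    · exact linkEdges_append_subset_right _ _ he

/-- `l'` is a rearrangement of the path `l` with the same last vertex, which keeps the edge `uv`
and such that every lost edge has an end in `U`. -/
structure Rearranges (R : SimpleGraph V) (u v : V) (l : List V) (U : Finset V) (l' : List V) :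
    Prop where
  perm : l'.Perm l
  chain : l'.IsChain R.Adj
  last : l'.getLast? = l.getLast?
  keep : s(u, v) ∈ linkEdges l → s(u, v) ∈ linkEdges l'
  lost : ∀ e ∈ linkEdges l, e ∉ linkEdges l' → ∃ w ∈ U, w ∈ e

lemma Rearranges.mono {R : SimpleGraph V} {u v : V} {l l' : List V} {U U' : Finset V}
    (h : Rearranges R u v l U l') (hU : U ⊆ U') : Rearranges R u v l U' l' :=
  ⟨h.perm, h.chain, h.last, h.keep, fun e he he' =>
    let ⟨w, hw, hwe⟩ := h.lost e he he'
    ⟨w, hU hw, hwe⟩⟩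

/-- The number of edges of the path `l` that are missing in `l'`. -/
def lostCard [DecidableEq V] (l l' : List V) : ℕ :=
  ((linkEdges l).toFinset \ (linkEdges l').toFinset).card

lemma lostCard_le_add [DecidableEq V] (l₁ l₂ l₃ : List V) :
    lostCard l₁ l₃ ≤ lostCard l₁ l₂ + lostCard l₂ l₃ := by
  unfold lostCard
  refine (Finset.card_le_card ?_).trans (Finset.card_union_le _ _)
  intro e
  simp only [Finset.mem_sdiff, Finset.mem_union]
  tauto

lemma lostCard_reverse_left [DecidableEq V] (l l' : List V) :
    lostCard l.reverse l' = lostCard l l' := by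
  unfold lostCard
  rw [linkEdges_reverse, List.toFinset_reverse]

/-- Every lost edge meets U, so if y, w₁ and w₂ avoid U, both edges of l at y survive in l'. The
candidates for the new head can thus be read off from the original path l, whatever l' is, and U
need only absorb the new head. -/
lemma Rearranges.rotate [DecidableEq V] {G R : SimpleGraph V} (hGR : G ≤ R) {u v : V}
    {l l' : List V} {U : Finset V} (h : Rearranges R u v l U l') (hn : l.Nodup) {x y w₁ w₂ : V}
    (hx : l'.head? = some x) (hxy : G.Adj x y) (hw : w₁ ≠ w₂) (h₁ : s(w₁, y) ∈ linkEdges l)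
    (h₂ : s(w₂, y) ∈ linkEdges l) (hy : y ∉ U) (hw₁ : w₁ ∉ U) (hw₂ : w₂ ∉ U) (hu : y ≠ u)
    (hv : y ≠ v) :
    ∃ z, (z = w₁ ∨ z = w₂) ∧ ∃ l'', Rearranges R u v l (insert z U) l'' ∧ l''.head? = some z ∧
      lostCard l l'' ≤ lostCard l l' + 1 := by
  have key : ∀ w, w ∉ U → s(w, y) ∈ linkEdges l → s(w, y) ∈ linkEdges l' := by
    intro w hw hm
    by_contra hcon
    obtain ⟨a, ha, ha'⟩ := h.lost _ hm hcon
    rcases Sym2.mem_iff.1 ha' with rfl | rfl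
    · exact hw ha
    · exact hy ha
  obtain ⟨z, hz, l'', hp, hc, hl, hh, he⟩ := exists_rotation hGR h.chain
    (h.perm.nodup_iff.2 hn) hx hxy hw (key _ hw₁ h₁) (key _ hw₂ h₂)
  refine ⟨z, hz, l'', ⟨hp.trans h.perm, hc, hl.trans h.last, ?_, ?_⟩, hh, ?_⟩
  · intro huv
    refine he _ (h.keep huv) ?_
    intro heq
    rcases Sym2.eq_iff.1 heq with ⟨_, h2⟩ | ⟨h2, _⟩
    · exact hv h2.symm
    · exact hu h2.symm
  · intro e hel hel'
    by_cases hez : e = s(z, y)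
    · exact ⟨z, by simp, by simp [hez]⟩
    · have : e ∉ linkEdges l' := fun h' => hel' (he e h' hez)
      obtain ⟨w, hwU, hwe⟩ := h.lost e hel this
      exact ⟨w, Finset.mem_insert_of_mem hwU, hwe⟩
  · unfold lostCard
    calc _ ≤ (insert s(z, y) ((linkEdges l).toFinset \ (linkEdges l').toFinset)).card := by
          apply Finset.card_le_card
          intro e
          simp only [Finset.mem_sdiff, Finset.mem_insert, List.mem_toFinset]
          rintro ⟨h1, h2⟩
          by_cases hez : e = s(z, y)
          · exact Or.inl hez
          · exact Or.inr ⟨h1, fun h' => h2 (he e h' hez)⟩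
      _ ≤ _ := Finset.card_insert_le _ _

/-! ### Expansion into pivots and rotations inside a fixed set. -/

/-- Any two disjoint sets of at least `t` vertices are joined by an edge. -/
def JoinedAbove (G : SimpleGraph V) (t : ℕ) : Prop :=
  ∀ A B : Finset V, Disjoint A B → t ≤ A.card → t ≤ B.card → ∃ a ∈ A, ∃ b ∈ B, G.Adj a b

/-- Disjointness is traded for size: a t-subset of B is removed from A. -/
lemma JoinedAbove.exists_adj [DecidableEq V] {G : SimpleGraph V} {t : ℕ} (h : G.JoinedAbove t)
    {A B : Finset V} (hA : 2 * t ≤ A.card) (hB : t ≤ B.card) : ∃ a ∈ A, ∃ b ∈ B, G.Adj a b := by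
  obtain ⟨B', hB', hc⟩ := Finset.exists_subset_card_eq hB
  obtain ⟨a, ha, b, hb, hab⟩ := h (A \ B') B' Finset.sdiff_disjoint
    (by have := Finset.le_card_sdiff B' A; omega) hc.ge
  exact ⟨a, (Finset.mem_sdiff.1 ha).1, b, hB' hb, hab⟩

open Classical in
/-- The indices in `I` of the vertices `e i` adjacent to some vertex of `S`. -/
noncomputable def nbrIdx {ι : Type*} (G : SimpleGraph V) (e : ι → V) (I : Finset ι)
    (S : Finset V) : Finset ι :=
  I.filter (fun i => ∃ x ∈ S, G.Adj x (e i))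

lemma mem_nbrIdx {ι : Type*} {G : SimpleGraph V} {e : ι → V} {I : Finset ι} {S : Finset V}
    {i : ι} : i ∈ nbrIdx G e I S ↔ i ∈ I ∧ ∃ x ∈ S, G.Adj x (e i) := by
  simp [nbrIdx]

lemma card_filter_mem_le {ι : Type*} [DecidableEq V] {I : Finset ι} {e : ι → V}
    (he : Set.InjOn e I) (D : Finset V) : (I.filter (fun i => e i ∈ D)).card ≤ D.card := by
  apply Finset.card_le_card_of_injOn e
  · intro i hi
    exact (Finset.mem_filter.1 (Finset.mem_coe.1 hi)).2
  · exact he.mono (Finset.coe_subset.2 (Finset.filter_subset _ _))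

/-- In a graph in which any two disjoint sets of `t` vertices are joined, deleting few vertices
makes small sets expand into the indices whose both companions `p i`, `q i` survive. -/
lemma exists_expanding_set {ι : Type*} [Fintype V] [DecidableEq V] {G : SimpleGraph V} {t : ℕ}
    (hG : G.JoinedAbove t) {I : Finset ι} {e p q : ι → V} (he : Set.InjOn e I)
    (hp : Set.InjOn p I) (hq : Set.InjOn q I) (hI : 16 * t ≤ I.card) :
    ∃ W : Finset V, 3 * t ≤ (I.filter (fun i => p i ∈ W ∧ q i ∈ W)).card ∧
      ∀ S ⊆ W, S.Nonempty → S.card ≤ t →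
        3 * S.card < (nbrIdx G e (I.filter (fun i => p i ∈ W ∧ q i ∈ W)) S).card := by
  classical
  let J : Finset V → Finset ι := fun D => I.filter (fun i => p i ∈ Dᶜ ∧ q i ∈ Dᶜ)
  have hJ : ∀ D, I.card ≤ (J D).card + 2 * D.card := by
    intro D
    have hsub : I ⊆ J D ∪ (I.filter (fun i => p i ∈ D) ∪ I.filter (fun i => q i ∈ D)) := by
      intro i hi
      simp only [J, Finset.mem_union, Finset.mem_filter, Finset.mem_compl]
      tauto
    have h1 := Finset.card_le_card hsub
    have h2 := Finset.card_union_le (J D) (I.filter (fun i => p i ∈ D) ∪ I.filter (fun i => q i ∈ D))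
    have h3 := Finset.card_union_le (I.filter (fun i => p i ∈ D)) (I.filter (fun i => q i ∈ D))
    have h4 := card_filter_mem_le hp D
    have h5 := card_filter_mem_le hq D
    omega
  -- The sets that fail to expand. A failing set of maximal size is deleted, and any failure in the
  -- rest could be added to it.
  let F : Finset (Finset V) := Finset.univ.filter
    (fun D => D.card ≤ 2 * t ∧ (nbrIdx G e (J D) D).card ≤ 3 * D.card)
  have hF : F.Nonempty := ⟨∅, Finset.mem_filter.2 ⟨Finset.mem_univ _, by simp, by simp [nbrIdx]⟩⟩
  obtain ⟨D, hDF, hmax⟩ := Finset.exists_max_image F Finset.card hF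
  have hD := (Finset.mem_filter.1 hDF).2
  -- Otherwise at least 16t - 4t indices survive, at most 6t of them are adjacent to D, and at most
  -- 2t of the remaining vertices lie in D. This leaves more than t vertices without an edge to D,
  -- against `hG`.
  have hDt : D.card < t := by
    by_contra! hcon
    obtain ⟨a, ha, b, hb, hab⟩ := hG D (((J D) \ nbrIdx G e (J D) D).image e \ D)
      Finset.disjoint_sdiff hcon (by
        have h1 := Finset.le_card_sdiff D (((J D) \ nbrIdx G e (J D) D).image e)
        have h2 : (((J D) \ nbrIdx G e (J D) D).image e).card
            = ((J D) \ nbrIdx G e (J D) D).card := by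
          apply Finset.card_image_of_injOn
          apply he.mono
          intro i hi
          exact (Finset.mem_filter.1 (Finset.mem_sdiff.1 (Finset.mem_coe.1 hi)).1).1
        have h3 := Finset.le_card_sdiff (nbrIdx G e (J D) D) (J D)
        have h4 := hJ D
        omega)
    obtain ⟨i, hi, rfl⟩ := Finset.mem_image.1 (Finset.mem_sdiff.1 hb).1
    have hi' := Finset.mem_sdiff.1 hi
    exact hi'.2 (mem_nbrIdx.2 ⟨hi'.1, a, ha, hab⟩)
  refine ⟨Dᶜ, ?_, ?_⟩
  · change 3 * t ≤ (J D).card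
    have := hJ D
    omega
  · intro S hS hne hSt
    change 3 * S.card < (nbrIdx G e (J D) S).card
    by_contra! hcon
    have hdis : Disjoint D S := by
      rw [Finset.disjoint_left]
      intro a ha ha'
      exact Finset.mem_compl.1 (hS ha') ha
    have hcard := Finset.card_union_of_disjoint hdis
    have hmem : D ∪ S ∈ F := by
      simp only [F, Finset.mem_filter, Finset.mem_univ, true_and]
      refine ⟨by omega, ?_⟩
      have hsub : nbrIdx G e (J (D ∪ S)) (D ∪ S) ⊆ nbrIdx G e (J D) D ∪ nbrIdx G e (J D) S := by
        intro i hi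
        obtain ⟨hi1, x, hx, hadj⟩ := mem_nbrIdx.1 hi
        have hiJ : i ∈ J D := by
          simp only [J, Finset.mem_filter, Finset.mem_compl, Finset.mem_union] at hi1 ⊢
          tauto
        rcases Finset.mem_union.1 hx with hx | hx
        · exact Finset.mem_union_left _ (mem_nbrIdx.2 ⟨hiJ, x, hx, hadj⟩)
        · exact Finset.mem_union_right _ (mem_nbrIdx.2 ⟨hiJ, x, hx, hadj⟩)
      have h1 := Finset.card_le_card hsub
      have h2 := Finset.card_union_le (nbrIdx G e (J D) D) (nbrIdx G e (J D) S)
      omega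
    have := hmax _ hmem
    have := hne.card_pos
    omega

/-- By injectivity each vertex of U spoils at most three indices. -/
lemma exists_free_index {ι : Type*} [DecidableEq V] {N I : Finset ι} {e p q : ι → V}
    (hN : N ⊆ I) (he : Set.InjOn e I) (hp : Set.InjOn p I) (hq : Set.InjOn q I) {U : Finset V}
    (h : 3 * U.card < N.card) : ∃ i ∈ N, e i ∉ U ∧ p i ∉ U ∧ q i ∉ U := by
  classical
  by_contra! hcon
  have hsub : N ⊆ I.filter (fun i => e i ∈ U) ∪
      (I.filter (fun i => p i ∈ U) ∪ I.filter (fun i => q i ∈ U)) := by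
    intro i hi
    have := hcon i hi
    have := hN hi
    simp only [Finset.mem_union, Finset.mem_filter]
    tauto
  have h1 := Finset.card_le_card hsub
  have h2 := Finset.card_union_le (I.filter (fun i => e i ∈ U))
    (I.filter (fun i => p i ∈ U) ∪ I.filter (fun i => q i ∈ U))
  have h3 := Finset.card_union_le (I.filter (fun i => p i ∈ U)) (I.filter (fun i => q i ∈ U))
  have h4 := card_filter_mem_le he U
  have h5 := card_filter_mem_le hp U
  have h6 := card_filter_mem_le hq U
  omega

/-- Pósa's rotation argument inside a set `W` in which small sets expand into pivots. -/
lemma exists_many_heads {ι : Type*} [Fintype V] [DecidableEq V] {G R : SimpleGraph V}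
    (hGR : G ≤ R) {u v : V} {l : List V} (hc : l.IsChain R.Adj) (hn : l.Nodup) {x₀ : V}
    (hx₀ : l.head? = some x₀) {I : Finset ι} {e p q : ι → V} (he : Set.InjOn e I)
    (hp : Set.InjOn p I) (hq : Set.InjOn q I) (hpq : ∀ i ∈ I, p i ≠ q i)
    (hpe : ∀ i ∈ I, s(p i, e i) ∈ linkEdges l) (hqe : ∀ i ∈ I, s(q i, e i) ∈ linkEdges l)
    (hu : ∀ i ∈ I, e i ≠ u) (hv : ∀ i ∈ I, e i ≠ v) {W : Finset V}
    (hpW : ∀ i ∈ I, p i ∈ W) (hqW : ∀ i ∈ I, q i ∈ W) {t : ℕ}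
    (hW : ∀ S ⊆ W, S.Nonempty → S.card ≤ t → 3 * S.card < (nbrIdx G e I S).card)
    {i₀ : ι} (hi₀ : i₀ ∈ I) (hadj : G.Adj x₀ (e i₀)) :
    ∃ X : Finset V, t < X.card ∧
      ∀ x ∈ X, ∃ l', Rearranges R u v l X l' ∧ l'.head? = some x := by
  classical
  let F : Finset (Finset V) := Finset.univ.filter (fun X => X ⊆ W ∧ X.Nonempty ∧
    ∀ x ∈ X, ∃ l', Rearranges R u v l X l' ∧ l'.head? = some x)
  have hF : F.Nonempty := by
    obtain ⟨z, hz, l', hl', hh, _⟩ := Rearranges.rotate hGR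
      (⟨.refl _, hc, rfl, id, fun e h h' => absurd h h'⟩ : Rearranges R u v l ∅ l) hn hx₀ hadj
      (hpq _ hi₀) (hpe _ hi₀) (hqe _ hi₀) (by simp) (by simp) (by simp) (hu _ hi₀) (hv _ hi₀)
    refine ⟨{z}, ?_⟩
    simp only [F, Finset.mem_filter, Finset.mem_univ, true_and, Finset.singleton_subset_iff,
      Finset.singleton_nonempty, Finset.mem_singleton, forall_eq]
    refine ⟨?_, l', hl', hh⟩
    rcases hz with rfl | rfl
    · exact hpW _ hi₀
    · exact hqW _ hi₀
  obtain ⟨X, hXF, hmax⟩ := Finset.exists_max_image F Finset.card hF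
  obtain ⟨hXW, hXne, hX⟩ := (Finset.mem_filter.1 hXF).2
  refine ⟨X, ?_, hX⟩
  -- If |X| ≤ t, one of its more than 3|X| pivots avoids X together with both its path neighbours.
  -- Rotating there gives a new head, which lies in W because both path neighbours do.
  by_contra! hcon
  obtain ⟨i, hi, h1, h2, h3⟩ := exists_free_index (fun i hi => (mem_nbrIdx.1 hi).1) he hp hq
    (hW X hXW hXne hcon)
  obtain ⟨hiI, x, hxX, hxadj⟩ := mem_nbrIdx.1 hi
  obtain ⟨l', hl', hh⟩ := hX x hxX
  obtain ⟨z, hz, l'', hl'', hh'', _⟩ := hl'.rotate hGR hn hh hxadj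
    (hpq _ hiI) (hpe _ hiI) (hqe _ hiI) h1 h2 h3 (hu _ hiI) (hv _ hiI)
  have hzX : z ∉ X := by rcases hz with rfl | rfl <;> assumption
  have hzW : z ∈ W := by
    rcases hz with rfl | rfl
    · exact hpW _ hiI
    · exact hqW _ hiI
  have hmem : insert z X ∈ F := by
    simp only [F, Finset.mem_filter, Finset.mem_univ, true_and]
    refine ⟨Finset.insert_subset hzW hXW, by simp, fun x hx => ?_⟩
    rcases Finset.mem_insert.1 hx with rfl | hx
    · exact ⟨l'', hl'', hh''⟩
    · obtain ⟨l₁, hl₁, hh₁⟩ := hX x hx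
      exact ⟨l₁, hl₁.mono (Finset.subset_insert _ _), hh₁⟩
  have := hmax _ hmem
  rw [Finset.card_insert_of_notMem hzX] at this
  omega

/-! ### A common subfamily by averaging. -/

/-- If many sets `F x` are large in `range m`, some `h`-set lies in many of them. -/
lemma exists_common_subset {α : Type*} (P : Finset α) (F : α → Finset ℕ) {m g h : ℕ}
    (hF : ∀ x ∈ P, F x ⊆ Finset.range m) (hg : ∀ x ∈ P, g ≤ (F x).card) (hh : h ≤ m)
    (hm : m ≤ 6 * (g + 1 - h)) :
    ∃ C ⊆ Finset.range m, C.card = h ∧ ∃ P' ⊆ P, (∀ x ∈ P', C ⊆ F x) ∧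
      P.card ≤ P'.card * 6 ^ h := by
  classical
  have hne : ((Finset.range m).powersetCard h).Nonempty := by
    rw [Finset.powersetCard_nonempty]; simpa
  obtain ⟨C, hC, hmax⟩ := Finset.exists_max_image _
    (fun C => (P.filter (fun x => C ⊆ F x)).card) hne
  obtain ⟨hC1, hC2⟩ := Finset.mem_powersetCard.1 hC
  refine ⟨C, hC1, hC2, P.filter (fun x => C ⊆ F x), Finset.filter_subset _ _,
    fun x hx => (Finset.mem_filter.1 hx).2, ?_⟩
  set k := (P.filter (fun x => C ⊆ F x)).card with hk
  have h1 : ∑ C ∈ (Finset.range m).powersetCard h, (P.filter (fun x => C ⊆ F x)).card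
      = ∑ x ∈ P, (((Finset.range m).powersetCard h).filter (fun C => C ⊆ F x)).card := by
    simp only [Finset.card_filter]
    exact Finset.sum_comm
  have h2 : ∑ C ∈ (Finset.range m).powersetCard h, (P.filter (fun x => C ⊆ F x)).card
      ≤ m.choose h * k := by
    have := Finset.sum_le_card_nsmul _ _ k hmax
    simpa [Finset.card_powersetCard] using this
  have h3 : P.card * g.choose h
      ≤ ∑ x ∈ P, (((Finset.range m).powersetCard h).filter (fun C => C ⊆ F x)).card := by
    rw [← smul_eq_mul]
    apply Finset.card_nsmul_le_sum
    intro x hx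
    calc g.choose h ≤ (F x).card.choose h := Nat.choose_le_choose _ (hg x hx)
      _ = ((F x).powersetCard h).card := (Finset.card_powersetCard _ _).symm
      _ ≤ _ := by
        apply Finset.card_le_card
        intro D hD
        obtain ⟨hD1, hD2⟩ := Finset.mem_powersetCard.1 hD
        exact Finset.mem_filter.2
          ⟨Finset.mem_powersetCard.2 ⟨hD1.trans (hF x hx), hD2⟩, hD1⟩
  rcases Nat.eq_zero_or_pos (g + 1 - h) with h0 | hpos
  · have : h = 0 := by omega
    subst this
    have : C = ∅ := Finset.card_eq_zero.1 hC2
    subst this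
    simp [hk]
  -- Double counting needs C(m, h) ≤ 6^h C(g, h). This follows from bounding h! C(g, h) below by (g
  -- + 1 - h)^h and h! C(m, h) above by m^h.
  have h4 : (g + 1 - h) ^ h ≤ h.factorial * g.choose h := Nat.pow_sub_le_descFactorial g h |>.trans
    (Nat.descFactorial_eq_factorial_mul_choose g h).le
  have h5 : h.factorial * m.choose h ≤ m ^ h :=
    (Nat.descFactorial_eq_factorial_mul_choose m h).ge.trans (Nat.descFactorial_le_pow m h)
  have h6 : P.card * (g + 1 - h) ^ h ≤ (k * 6 ^ h) * (g + 1 - h) ^ h := by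
    calc P.card * (g + 1 - h) ^ h ≤ P.card * (h.factorial * g.choose h) := by gcongr
      _ = h.factorial * (P.card * g.choose h) := by ring
      _ ≤ h.factorial * (m.choose h * k) := by
          exact Nat.mul_le_mul_left _ (h3.trans (h1 ▸ h2))
      _ = h.factorial * m.choose h * k := by ring
      _ ≤ (6 * (g + 1 - h)) ^ h * k := by
          gcongr; exact h5.trans (Nat.pow_le_pow_left hm h)
      _ = _ := by rw [mul_pow]; ring
  exact Nat.le_of_mul_le_mul_right h6 (by positivity)

/-! ### Growth of the set of attainable first vertices. -/

lemma mem_externalNeighborhood [Fintype V] {G : SimpleGraph V} {S : Finset V} {v : V} :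
    v ∈ G.externalNeighborhood S ↔ v ∉ S ∧ ∃ u ∈ S, G.Adj u v := by
  simp [externalNeighborhood]

/-- Every vertex of `S` is the first vertex of a rearrangement of `l` that has lost at most `k`
edges of `l`, each of them meeting `U`. -/
structure IsHeadSet [DecidableEq V] (R : SimpleGraph V) (u v : V) (l : List V) (S U : Finset V)
    (k : ℕ) : Prop where
  subset : S ⊆ U
  head_mem : ∀ x, l.head? = some x → x ∈ U
  exists_rearranges : ∀ x ∈ S, ∃ l', Rearranges R u v l U l' ∧ l'.head? = some x ∧
    lostCard l l' ≤ k

/-- No rearrangement of `l` through the edge `uv` can be prolonged at its first vertex. -/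
def IsUnextendable (G R : SimpleGraph V) (u v : V) (l : List V) : Prop :=
  ∀ l' : List V, l'.Perm l → l'.IsChain R.Adj → s(u, v) ∈ linkEdges l' →
    ∀ x, l'.head? = some x → ∀ y, G.Adj x y → y ∈ l

lemma injOn_getD {l : List V} (hn : l.Nodup) (a : V) :
    Set.InjOn (fun i => l.getD i a) {i | i < l.length} := by
  intro i hi j hj hij
  simp only [Set.mem_ofPred_eq] at hi hj
  simp only [List.getD_eq_getElem _ _ hi, List.getD_eq_getElem _ _ hj] at hij
  exact (hn.getElem_inj_iff).1 hij

lemma mem_linkEdges_getD (l : List V) (a : V) {i : ℕ} (h : i + 1 < l.length) :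
    s(l.getD i a, l.getD (i + 1) a) ∈ linkEdges l := by
  rw [List.getD_eq_getElem _ _ h, List.getD_eq_getElem _ _ (by omega)]
  exact mem_linkEdges_getElem l i h

/-- By `hmax` all neighbours of S lie on l. Up to three are wasted as u, v or the last vertex, and
up to 3|U| because they or a path neighbour of theirs lie in U, which contains the first vertex.
Each other neighbour gives a rotation whose new head is next to it on l, and a head arises from at
most two of them. -/
lemma IsHeadSet.step [Fintype V] [DecidableEq V] {G R : SimpleGraph V} (hGR : G ≤ R) {u v : V}
    {l : List V} (hn : l.Nodup) (huv : s(u, v) ∈ linkEdges l) (hmax : IsUnextendable G R u v l)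
    {S U : Finset V} {k : ℕ} (h : IsHeadSet R u v l S U k) :
    ∃ S' : Finset V, (G.externalNeighborhood S).card ≤ 2 * S'.card + 3 * U.card + 3 ∧
      ∀ S'' ⊆ S', IsHeadSet R u v l S'' (U ∪ S'') (k + 1) := by
  classical
  let S' : Finset V := Finset.univ.filter (fun z => ∃ l', Rearranges R u v l (insert z U) l' ∧
    l'.head? = some z ∧ lostCard l l' ≤ k + 1)
  refine ⟨S', ?_, ?_⟩
  swap
  · intro S'' hS''
    refine ⟨Finset.subset_union_right, fun x hx => Finset.mem_union_left _ (h.head_mem x hx), ?_⟩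
    intro x hx
    obtain ⟨l', h1, h2⟩ := (Finset.mem_filter.1 (hS'' hx)).2
    refine ⟨l', h1.mono ?_, h2⟩
    exact Finset.insert_subset (Finset.mem_union_right _ hx) Finset.subset_union_left
  let f : ℕ → V := fun i => l.getD i u
  let I : Finset ℕ := (Finset.range l.length).filter
    (fun i => 1 ≤ i ∧ i + 1 < l.length ∧ f i ≠ u ∧ f i ≠ v)
  have hI : ∀ i ∈ I, 1 ≤ i ∧ i + 1 < l.length ∧ f i ≠ u ∧ f i ≠ v :=
    fun i hi => (Finset.mem_filter.1 hi).2
  have hf := injOn_getD hn u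
  have he : Set.InjOn f I := fun i hi j hj hij => by
    have h1 := hI i hi
    have h2 := hI j hj
    exact hf (show i < _ by omega) (show j < _ by omega) hij
  have hp : Set.InjOn (fun i => f (i - 1)) I := fun i hi j hj hij => by
    have h1 := hI i hi
    have h2 := hI j hj
    have := hf (show i - 1 < _ by omega) (show j - 1 < _ by omega) hij
    omega
  have hq : Set.InjOn (fun i => f (i + 1)) I := fun i hi j hj hij => by
    have h1 := hI i hi
    have h2 := hI j hj
    have := hf (show i + 1 < _ by omega) (show j + 1 < _ by omega) hij
    omega
  let Y := (nbrIdx G f I S).filter (fun i => f i ∉ U ∧ f (i - 1) ∉ U ∧ f (i + 1) ∉ U)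
  have hYS : ∀ i ∈ Y, f (i - 1) ∈ S' ∨ f (i + 1) ∈ S' := by
    intro i hi
    obtain ⟨hi1, hi2, hi3, hi4⟩ := Finset.mem_filter.1 hi
    obtain ⟨hiI, x, hx, hadj⟩ := mem_nbrIdx.1 hi1
    obtain ⟨h1, h2, h3, h4⟩ := hI i hiI
    obtain ⟨l', hl', hh, hk⟩ := h.exists_rearranges x hx
    obtain ⟨z, hz, l'', hl'', hh', hk'⟩ := hl'.rotate hGR hn hh hadj
      (w₁ := f (i - 1)) (w₂ := f (i + 1))
      (fun h => by
        have := hf (show i - 1 < _ by omega) (show i + 1 < _ by omega) h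
        omega)
      (by
        have := mem_linkEdges_getD l u (i := i - 1) (by omega)
        rwa [Nat.sub_add_cancel h1] at this)
      (by
        have := mem_linkEdges_getD l u (i := i) (by omega)
        rwa [Sym2.eq_swap])
      hi2 hi3 hi4 h3 h4
    have hz' : z ∈ S' := Finset.mem_filter.2 ⟨Finset.mem_univ _, l'', hl'', hh', by omega⟩
    rcases hz with rfl | rfl
    · exact Or.inl hz'
    · exact Or.inr hz'
  have hY : Y.card ≤ 2 * S'.card := by
    have hsub : Y ⊆ I.filter (fun i => f (i - 1) ∈ S') ∪ I.filter (fun i => f (i + 1) ∈ S') := by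
      intro i hi
      have h1 := hYS i hi
      have h2 : i ∈ I := (mem_nbrIdx.1 (Finset.mem_filter.1 hi).1).1
      simp only [Finset.mem_union, Finset.mem_filter]
      tauto
    have h1 := Finset.card_le_card hsub
    have h2 := Finset.card_union_le (I.filter (fun i => f (i - 1) ∈ S'))
      (I.filter (fun i => f (i + 1) ∈ S'))
    have h3 := card_filter_mem_le hp S'
    have h4 := card_filter_mem_le hq S'
    omega
  have hN : G.externalNeighborhood S ⊆ {u, v, f (l.length - 1)} ∪ U ∪
      (Y ∪ (I.filter (fun i => f (i - 1) ∈ U) ∪ I.filter (fun i => f (i + 1) ∈ U))).image f := by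
    intro y hy
    obtain ⟨hyS, x, hx, hadj⟩ := mem_externalNeighborhood.1 hy
    obtain ⟨l', hl', hh, hk⟩ := h.exists_rearranges x hx
    have hyl := hmax l' hl'.perm hl'.chain (hl'.keep huv) x hh y hadj
    obtain ⟨i, hi, rfl⟩ := List.getElem_of_mem hyl
    have hfi : f i = l[i] := List.getD_eq_getElem _ _ hi
    rw [← hfi] at hadj ⊢
    by_contra hcon
    simp only [Finset.mem_union, Finset.mem_insert, Finset.mem_singleton, Finset.mem_image,
      not_or, not_exists, not_and] at hcon
    obtain ⟨⟨⟨hu, hv, hlast⟩, hU⟩, him⟩ := hcon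
    have hi0 : i ≠ 0 := by
      rintro rfl
      apply hU
      apply h.head_mem
      rw [hfi, List.head?_eq_getElem?, List.getElem?_eq_getElem hi]
    have hil : i + 1 < l.length := by
      by_contra hc
      have : i = l.length - 1 := by omega
      exact hlast (by rw [← this])
    have hiI : i ∈ I := Finset.mem_filter.2 ⟨Finset.mem_range.2 hi, by omega, hil, hu, hv⟩
    refine him i ?_ rfl
    have hnb : i ∈ nbrIdx G f I S := mem_nbrIdx.2 ⟨hiI, x, hx, hadj⟩
    simp only [Y, Finset.mem_filter]
    tauto
  have h1 := Finset.card_le_card hN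
  have h2 := Finset.card_union_le ({u, v, f (l.length - 1)} ∪ U)
    ((Y ∪ (I.filter (fun i => f (i - 1) ∈ U) ∪ I.filter (fun i => f (i + 1) ∈ U))).image f)
  have h3 := Finset.card_union_le {u, v, f (l.length - 1)} U
  have h4 : ({u, v, f (l.length - 1)} : Finset V).card ≤ 3 := Finset.card_le_three
  have h5 := Finset.card_image_le (f := f)
    (s := Y ∪ (I.filter (fun i => f (i - 1) ∈ U) ∪ I.filter (fun i => f (i + 1) ∈ U)))
  have h6 := Finset.card_union_le Y
    (I.filter (fun i => f (i - 1) ∈ U) ∪ I.filter (fun i => f (i + 1) ∈ U))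
  have h7 := Finset.card_union_le (I.filter (fun i => f (i - 1) ∈ U))
    (I.filter (fun i => f (i + 1) ∈ U))
  have h8 := card_filter_mem_le hp U
  have h9 := card_filter_mem_le hq U
  omega

/-- Sets of at most `M` vertices expand by the factor `d`. -/
def ExpandsUpTo [Fintype V] (G : SimpleGraph V) (d : ℝ) (M : ℕ) : Prop :=
  ∀ S : Finset V, S.card ≤ M → d * (S.card : ℝ) ≤ ((G.externalNeighborhood S).card : ℝ)

/-- Fewer than t vertices outside S can lack a neighbour in S. -/
lemma JoinedAbove.card_le [Fintype V] [DecidableEq V] {G : SimpleGraph V} {t : ℕ}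
    (hG : G.JoinedAbove t) {S : Finset V} (hS : S.card = t) :
    Fintype.card V < (G.externalNeighborhood S).card + 2 * t ∨ t = 0 := by
  by_contra! hcon
  have h1 := Finset.card_union_le S (G.externalNeighborhood S)
  have h2 := Finset.card_compl (S ∪ G.externalNeighborhood S)
  obtain ⟨a, ha, b, hb, hab⟩ := hG S (S ∪ G.externalNeighborhood S)ᶜ
    (by
      rw [Finset.disjoint_left]
      intro a ha ha'
      simp [ha] at ha') hS.ge (by omega)
  simp only [Finset.mem_compl, Finset.mem_union, not_or, mem_externalNeighborhood] at hb
  exact hb.2 ⟨hb.1, a, ha, hab⟩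

section Growth

variable [Fintype V] [DecidableEq V] {G R : SimpleGraph V} {u v : V} {l : List V} {d : ℝ}
  {M r t : ℕ}

/-- Here 3c + 3 ≤ 6s ≤ ds/2, so at least half of the ds neighbours are useful, and every new head
serves at most two of them. -/
lemma card_growth {s s' c N : ℕ} {d : ℝ} {r : ℕ} (hd : 12 ≤ d) (hr : (4 * r : ℝ) ≤ d)
    (hs : 1 ≤ s) (hU : 2 * c + 1 ≤ 3 * s) (h1 : d * s ≤ N) (h2 : N ≤ 2 * s' + 3 * c + 3) :
    r * s ≤ s' := by
  have h2' : (N : ℝ) ≤ 2 * s' + 3 * c + 3 := by exact_mod_cast h2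
  have hU' : (2 * c + 1 : ℝ) ≤ 3 * s := by exact_mod_cast hU
  have hs' : (1 : ℝ) ≤ s := by exact_mod_cast hs
  have h3 : (4 * r : ℝ) * s ≤ d * s := by gcongr
  have h4 : (12 : ℝ) * s ≤ d * s := by gcongr
  have : (r * s : ℝ) ≤ s' := by linarith
  exact_mod_cast this

/-- The exceptional set U collects all earlier head sets. Their sizes grow at least by the factor 3,
so their sum stays below 3/2 times the last one, as `card_growth` requires. -/
lemma exists_isHeadSet_pow (hGR : G ≤ R) (hc : l.IsChain R.Adj) (hn : l.Nodup)
    (huv : s(u, v) ∈ linkEdges l) (hmax : IsUnextendable G R u v l) (hd : 12 ≤ d) (hr3 : 3 ≤ r)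
    (hr : (4 * r : ℝ) ≤ d) (hP : G.ExpandsUpTo d M) (k : ℕ) (hk : r ^ k ≤ M) :
    ∃ S U : Finset V, IsHeadSet R u v l S U k ∧ S.card = r ^ k ∧ 2 * U.card + 1 ≤ 3 * S.card := by
  induction k with
  | zero =>
    cases l with
    | nil => simp at huv
    | cons x l =>
      refine ⟨{x}, {x}, ⟨subset_rfl, by simp, ?_⟩, by simp, by simp⟩
      intro y hy
      rw [Finset.mem_singleton] at hy
      subst hy
      exact ⟨_, ⟨.refl _, hc, rfl, id, fun e h h' => absurd h h'⟩, rfl, by simp [lostCard]⟩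
  | succ k ih =>
    have hle : r ^ k ≤ r ^ (k + 1) := Nat.pow_le_pow_right (by omega) (by omega)
    obtain ⟨S, U, hSU, hS, hU⟩ := ih (hle.trans hk)
    obtain ⟨S', hS', hstep⟩ := hSU.step hGR hn huv hmax
    have hpos : 1 ≤ S.card := by rw [hS]; exact Nat.one_le_pow _ _ (by omega)
    have hcard := card_growth hd hr hpos hU (hP S (by omega)) hS'
    obtain ⟨S'', hsub, hS''⟩ := Finset.exists_subset_card_eq hcard
    refine ⟨S'', _, hstep S'' hsub, by rw [hS'', hS, pow_succ, mul_comm], ?_⟩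
    have h1 := Finset.card_union_le U S''
    have h2 : 3 * S.card ≤ r * S.card := Nat.mul_le_mul_right _ hr3
    omega

/-- A longest path can be rearranged to start at any vertex of a set of linear size, with few
edges lost and the last vertex fixed. -/
lemma exists_many_rearrangements (hGR : G ≤ R) (hc : l.IsChain R.Adj) (hn : l.Nodup)
    (huv : s(u, v) ∈ linkEdges l) (hmax : IsUnextendable G R u v l) (hd : 12 ≤ d) (hr3 : 3 ≤ r)
    (hr : (4 * r : ℝ) ≤ d) (hP : G.ExpandsUpTo d M) (hG : G.JoinedAbove t) (hM : 1 ≤ M)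
    (ht : 1 ≤ t) (hMt : (16 * t : ℝ) ≤ d * M) (hcard : 15 * t + 23 * M + 9 ≤ Fintype.card V)
    {K : ℕ} (hK : M < r ^ K) :
    ∃ B : Finset V, Fintype.card V ≤ 3 * B.card ∧ ∀ x ∈ B, ∃ l', Rearranges R u v l .univ l' ∧
      l'.head? = some x ∧ lostCard l l' ≤ K + 2 := by
  have hex : ∃ k, r ^ k ≤ M ∧ M < r ^ (k + 1) ∧ k < K := by
    refine ⟨Nat.log r M, Nat.pow_log_le_self r (by omega),
      Nat.lt_pow_succ_log_self (by omega) M, ?_⟩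
    exact Nat.log_lt_of_lt_pow (by omega) hK
  obtain ⟨k, hk1, hk2, hkK⟩ := hex
  obtain ⟨S, U, hSU, hS, hU⟩ :=
    exists_isHeadSet_pow hGR hc hn huv hmax hd hr3 hr hP k hk1
  obtain ⟨S₁, hS₁, hstep₁⟩ := hSU.step hGR hn huv hmax
  have hpos : 1 ≤ S.card := by rw [hS]; exact Nat.one_le_pow _ _ (by omega)
  have hcard₁ := card_growth hd hr hpos hU (hP S (by omega)) hS₁
  rw [hS, mul_comm, ← pow_succ] at hcard₁
  -- Trimming to exactly M keeps P1 applicable. As dM ≥ 16t and the exceptional set has at most 5M/2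
  -- vertices, one more step reaches t.
  obtain ⟨T₁, hT₁, hT₁c⟩ := Finset.exists_subset_card_eq (show M ≤ S₁.card by omega)
  obtain ⟨S₂, hS₂, hstep₂⟩ := (hstep₁ T₁ hT₁).step hGR hn huv hmax
  have hU₁ := Finset.card_union_le U T₁
  have hcard₂ : t ≤ S₂.card := by
    have h1 := hP T₁ hT₁c.le
    have h2 : ((G.externalNeighborhood T₁).card : ℝ) ≤ 2 * S₂.card + 3 * (U ∪ T₁).card + 3 := by
      exact_mod_cast hS₂
    have h3 : (2 * (U ∪ T₁).card + 1 : ℝ) ≤ 5 * M := by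
      have : 2 * (U ∪ T₁).card + 1 ≤ 5 * M := by omega
      exact_mod_cast this
    rw [hT₁c] at h1
    have h4 : (1 : ℝ) ≤ M := by exact_mod_cast hM
    have h5 : (12 * M : ℝ) ≤ d * M := by gcongr
    have : (t : ℝ) ≤ S₂.card := by linarith
    exact_mod_cast this
  obtain ⟨T₂, hT₂, hT₂c⟩ := Finset.exists_subset_card_eq hcard₂
  obtain ⟨S₃, hS₃, hstep₃⟩ := (hstep₂ T₂ hT₂).step hGR hn huv hmax
  have hU₂ := Finset.card_union_le (U ∪ T₁) T₂
  have hN := hG.card_le hT₂c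
  -- T₂ has more than n - 2t neighbours, and the exceptional set has at most 5M/2 + t vertices, so
  -- `hcard` gives 3|S₃| ≥ n. In all k + 3 ≤ K + 2 rotations were made.
  refine ⟨S₃, by omega, fun x hx => ?_⟩
  obtain ⟨l', h1, h2, h3⟩ := (hstep₃ S₃ subset_rfl).exists_rearranges x hx
  exact ⟨l', h1.mono (Finset.subset_univ _), h2, by omega⟩

end Growth

/-! ### Cutting a rearranged path between unbroken segments. -/

lemma mem_linkEdges_append_iff {L R : List V} {z y : V} (hz : L.getLast? = some z)
    (hy : R.head? = some y) {e : Sym2 V} :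
    e ∈ linkEdges (L ++ R) ↔ e ∈ linkEdges L ∨ e = s(z, y) ∨ e ∈ linkEdges R := by
  obtain ⟨A, rfl⟩ := List.getLast?_eq_some_iff.1 hz
  obtain ⟨Q, rfl⟩ := List.head?_eq_some_iff.1 hy
  rw [List.append_assoc, List.singleton_append, linkEdges_append]
  simp

lemma exists_split_of_not_nil (p : List V → Prop) (h0 : ¬ p []) {l : List V} (hl : p l) :
    ∃ L x R, l = L ++ x :: R ∧ ¬ p L ∧ p (L ++ [x]) := by
  induction l using List.reverseRecOn with
  | nil => exact absurd hl h0
  | append_singleton l a ih =>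
    by_cases h : p l
    · obtain ⟨L, x, R, rfl, h1, h2⟩ := ih h
      exact ⟨L, x, R ++ [a], by simp, h1, h2⟩
    · exact ⟨l, a, [], rfl, h, hl⟩

open Classical in
/-- The segments `g j 0, …, g j (s - 1)` with `j ∈ J` that lie in the list `l`. -/
noncomputable def segmentsIn (g : ℕ → ℕ → V) (s : ℕ) (J : Finset ℕ) (l : List V) : Finset ℕ :=
  J.filter (fun j => ∀ r < s, g j r ∈ l)

lemma mem_segmentsIn {g : ℕ → ℕ → V} {s : ℕ} {J : Finset ℕ} {l : List V} {j : ℕ} :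
    j ∈ segmentsIn g s J l ↔ j ∈ J ∧ ∀ r < s, g j r ∈ l := by
  simp [segmentsIn]

lemma segmentsIn_subset (g : ℕ → ℕ → V) (s : ℕ) (J : Finset ℕ) (l : List V) :
    segmentsIn g s J l ⊆ J :=
  fun _ hj => (mem_segmentsIn.1 hj).1

/-- A path containing many unbroken segments can be cut so that both parts contain many. -/
lemma exists_cut {l : List V} (hn : l.Nodup) {g : ℕ → ℕ → V} {s : ℕ} (hs : 1 ≤ s) {J : Finset ℕ}
    (hg : ∀ j ∈ J, ∀ j' ∈ J, ∀ r < s, ∀ r' < s, g j r = g j' r' → j = j')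
    (hmem : ∀ j ∈ J, ∀ r < s, g j r ∈ l)
    (hedge : ∀ j ∈ J, ∀ r, r + 1 < s → s(g j r, g j (r + 1)) ∈ linkEdges l) {k : ℕ} (hk : 1 ≤ k)
    (hJ : 2 * k ≤ J.card) :
    ∃ L R, l = L ++ R ∧ k ≤ (segmentsIn g s J L).card ∧ k ≤ (segmentsIn g s J R).card := by
  classical
  -- The cut comes after the shortest prefix with k whole segments. Only the segment through x can
  -- be divided, and L holds at most k - 1, so at least 2k - 1 - (k - 1) = k segments lie in the
  -- remainder.
  obtain ⟨L, x, R, rfl, h1, h2⟩ := exists_split_of_not_nil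
    (fun l => k ≤ (segmentsIn g s J l).card) (l := l)
    (by
      have : segmentsIn g s J [] = ∅ := by
        ext j
        simp only [mem_segmentsIn, List.not_mem_nil, Finset.notMem_empty, iff_false, not_and]
        intro _ h
        exact h 0 hs
      rw [this]; simp; omega)
    (by
      have : segmentsIn g s J l = J := by
        ext j
        simp only [mem_segmentsIn, and_iff_left_iff_imp]
        exact hmem j
      rw [this]; omega)
  refine ⟨L ++ [x], R, by simp, h2, ?_⟩
  have hdis := List.nodup_append.1 hn
  have hxR : x ∉ R := (List.nodup_cons.1 hdis.2.1).1
  have hloc : ∀ j ∈ J, (∀ r < s, g j r ≠ x) → j ∈ segmentsIn g s J L ∪ segmentsIn g s J R := by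
    intro j hj hjx
    have hor : ∀ r < s, g j r ∈ L ∨ g j r ∈ R := by
      intro r hr
      have := hmem j hj r hr
      have := hjx r hr
      simp_all
    have hLR : ∀ a ∈ L, a ∉ R := fun a ha ha' =>
      hdis.2.2 a ha a (List.mem_cons_of_mem _ ha') rfl
    have hstep : ∀ r, r + 1 < s → (g j r ∈ L ↔ g j (r + 1) ∈ L) := by
      intro r hr
      have hmem' := hedge j hj r hr
      have hr0 := hjx r (by omega)
      have hr1 := hjx (r + 1) hr
      rcases mem_linkEdges_append hmem' with h | h | ⟨a, ha, b, hb, h⟩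
      · exact ⟨fun _ => mem_of_mem_linkEdges h (by simp), fun _ => mem_of_mem_linkEdges h (by simp)⟩
      · have i1 : g j r ∈ R := by
          have := mem_of_mem_linkEdges h (Sym2.mem_mk_left _ _)
          simp_all
        have i2 : g j (r + 1) ∈ R := by
          have := mem_of_mem_linkEdges h (Sym2.mem_mk_right _ _)
          simp_all
        exact ⟨fun h => absurd i1 (hLR _ h), fun h => absurd i2 (hLR _ h)⟩
      · obtain ⟨A, c, rfl⟩ := List.eq_nil_or_concat L |>.resolve_left (List.ne_nil_of_mem ha)
        rw [List.concat_eq_append, mem_linkEdges_append_iff (z := c) (y := x) (by simp)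
          (by simp)] at hmem'
        rcases hmem' with h' | h' | h'
        · have i1 := mem_of_mem_linkEdges h' (Sym2.mem_mk_left _ _)
          have i2 := mem_of_mem_linkEdges h' (Sym2.mem_mk_right _ _)
          rw [List.concat_eq_append]
          exact ⟨fun _ => i2, fun _ => i1⟩
        · rcases Sym2.eq_iff.1 h' with ⟨_, h3⟩ | ⟨h3, _⟩
          · exact absurd h3 hr1
          · exact absurd h3 hr0
        · have i1 : g j r ∈ R := by
            have := mem_of_mem_linkEdges h' (Sym2.mem_mk_left _ _)
            simp_all
          have i2 : g j (r + 1) ∈ R := by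
            have := mem_of_mem_linkEdges h' (Sym2.mem_mk_right _ _)
            simp_all
          exact ⟨fun h => absurd i1 (hLR _ h), fun h => absurd i2 (hLR _ h)⟩
    have hall : ∀ r < s, (g j r ∈ L ↔ g j 0 ∈ L) := by
      intro r
      induction r with
      | zero => intro _; rfl
      | succ r ih => intro hr; rw [← hstep r hr, ih (by omega)]
    by_cases h0 : g j 0 ∈ L
    · exact Finset.mem_union_left _ (mem_segmentsIn.2 ⟨hj, fun r hr => (hall r hr).2 h0⟩)
    · exact Finset.mem_union_right _ (mem_segmentsIn.2 ⟨hj, fun r hr =>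
        (hor r hr).resolve_left (fun h => h0 ((hall r hr).1 h))⟩)
  have hx1 : (J.filter (fun j => ∃ r < s, g j r = x)).card ≤ 1 := by
    rw [Finset.card_le_one]
    intro j hj j' hj'
    obtain ⟨hj, r, hr, h⟩ := Finset.mem_filter.1 hj
    obtain ⟨hj', r', hr', h'⟩ := Finset.mem_filter.1 hj'
    exact hg j hj j' hj' r hr r' hr' (h.trans h'.symm)
  have hsub : J ⊆ J.filter (fun j => ∃ r < s, g j r = x) ∪
      (segmentsIn g s J L ∪ segmentsIn g s J R) := by
    intro j hj
    by_cases h : ∃ r < s, g j r = x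
    · exact Finset.mem_union_left _ (Finset.mem_filter.2 ⟨hj, h⟩)
    · push Not at h
      exact Finset.mem_union_right _ (hloc j hj h)
  have c1 := Finset.card_le_card hsub
  have c2 := Finset.card_union_le (J.filter (fun j => ∃ r < s, g j r = x))
    (segmentsIn g s J L ∪ segmentsIn g s J R)
  have c3 := Finset.card_union_le (segmentsIn g s J L) (segmentsIn g s J R)
  omega

/-! ### Pivots in a family of segments. -/

open Classical in
/-- The inner positions of the segments in `C`, except those of `u` and `v`. -/
noncomputable def pivots (g : ℕ → ℕ → V) (s : ℕ) (u v : V) (C : Finset ℕ) : Finset (ℕ × ℕ) :=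
  (C ×ˢ Finset.Ioo 0 (s - 1)).filter (fun i => g i.1 i.2 ≠ u ∧ g i.1 i.2 ≠ v)

lemma mem_pivots {g : ℕ → ℕ → V} {s : ℕ} {u v : V} {C : Finset ℕ} {i : ℕ × ℕ} :
    i ∈ pivots g s u v C ↔
      i.1 ∈ C ∧ 0 < i.2 ∧ i.2 < s - 1 ∧ g i.1 i.2 ≠ u ∧ g i.1 i.2 ≠ v := by
  simp [pivots, and_assoc]

section Segments

variable {g : ℕ → ℕ → V} {s m : ℕ} {u v : V} {C : Finset ℕ}

/-- The vertices `g j r` with `j < m` and `r < s` are distinct. -/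
def InjSegments (g : ℕ → ℕ → V) (s m : ℕ) : Prop :=
  ∀ j < m, ∀ j' < m, ∀ r < s, ∀ r' < s, g j r = g j' r' → j = j' ∧ r = r'

lemma InjSegments.injOn (hg : InjSegments g s m) (hC : C ⊆ Finset.range m) :
    Set.InjOn (fun i : ℕ × ℕ => g i.1 i.2) (pivots g s u v C) := by
  intro i hi j hj hij
  have hi := mem_pivots.1 hi
  have hj := mem_pivots.1 hj
  have h := hg i.1 (Finset.mem_range.1 (hC hi.1)) j.1 (Finset.mem_range.1 (hC hj.1)) i.2 (by omega)
    j.2 (by omega) hij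
  exact Prod.ext h.1 h.2

lemma InjSegments.injOn_pred (hg : InjSegments g s m) (hC : C ⊆ Finset.range m) :
    Set.InjOn (fun i : ℕ × ℕ => g i.1 (i.2 - 1)) (pivots g s u v C) := by
  intro i hi j hj hij
  have hi := mem_pivots.1 hi
  have hj := mem_pivots.1 hj
  have h := hg i.1 (Finset.mem_range.1 (hC hi.1)) j.1 (Finset.mem_range.1 (hC hj.1)) (i.2 - 1)
    (by omega) (j.2 - 1) (by omega) hij
  exact Prod.ext h.1 (by omega)

lemma InjSegments.injOn_succ (hg : InjSegments g s m) (hC : C ⊆ Finset.range m) :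
    Set.InjOn (fun i : ℕ × ℕ => g i.1 (i.2 + 1)) (pivots g s u v C) := by
  intro i hi j hj hij
  have hi := mem_pivots.1 hi
  have hj := mem_pivots.1 hj
  have h := hg i.1 (Finset.mem_range.1 (hC hi.1)) j.1 (Finset.mem_range.1 (hC hj.1)) (i.2 + 1)
    (by omega) (j.2 + 1) (by omega) hij
  exact Prod.ext h.1 (by omega)

lemma InjSegments.le_card_pivots (hg : InjSegments g s m) (hC : C ⊆ Finset.range m) :
    C.card * (s - 2) ≤ (pivots g s u v C).card + 2 := by
  classical
  have hinj : Set.InjOn (fun i : ℕ × ℕ => g i.1 i.2)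
      ((C ×ˢ Finset.Ioo 0 (s - 1) : Finset (ℕ × ℕ)) : Set (ℕ × ℕ)) := by
    intro i hi j hj hij
    have hi := Finset.mem_product.1 hi
    have hj := Finset.mem_product.1 hj
    rw [Finset.mem_Ioo] at hi hj
    have h := hg i.1 (Finset.mem_range.1 (hC hi.1)) j.1 (Finset.mem_range.1 (hC hj.1)) i.2
      (by omega) j.2 (by omega) hij
    exact Prod.ext h.1 h.2
  have hsub : C ×ˢ Finset.Ioo 0 (s - 1) ⊆ pivots g s u v C ∪
      (C ×ˢ Finset.Ioo 0 (s - 1)).filter (fun i => g i.1 i.2 ∈ ({u, v} : Finset V)) := by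
    intro i hi
    simp only [pivots, Finset.mem_union, Finset.mem_filter, Finset.mem_insert,
      Finset.mem_singleton]
    tauto
  have h1 := Finset.card_le_card hsub
  have h2 := Finset.card_union_le (pivots g s u v C)
    ((C ×ˢ Finset.Ioo 0 (s - 1)).filter (fun i => g i.1 i.2 ∈ ({u, v} : Finset V)))
  have h3 := card_filter_mem_le hinj ({u, v} : Finset V)
  have h4 : ({u, v} : Finset V).card ≤ 2 := Finset.card_le_two
  rw [Finset.card_product, Nat.card_Ioo] at h1
  have h5 : s - 1 - 0 - 1 = s - 2 := by omega
  rw [h5] at h1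
  omega

/-- The pivots in the segments `C` whose two path neighbours lie in `W`. -/
noncomputable def pivotsIn [DecidableEq V] (g : ℕ → ℕ → V) (s : ℕ) (u v : V) (C : Finset ℕ)
    (W : Finset V) : Finset (ℕ × ℕ) :=
  (pivots g s u v C).filter (fun i => g i.1 (i.2 - 1) ∈ W ∧ g i.1 (i.2 + 1) ∈ W)

/-- Small subsets of `W` expand into the pivots of the segments in `C`. -/
structure ExpandsInto [DecidableEq V] (G : SimpleGraph V) (g : ℕ → ℕ → V) (s : ℕ) (u v : V)
    (C : Finset ℕ) (W : Finset V) (t : ℕ) : Prop where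
  le_card : 3 * t ≤ (pivotsIn g s u v C W).card
  expand : ∀ S ⊆ W, S.Nonempty → S.card ≤ t →
    3 * S.card < (nbrIdx G (fun i : ℕ × ℕ => g i.1 i.2) (pivotsIn g s u v C W) S).card

variable [DecidableEq V] {G R : SimpleGraph V} {t : ℕ} {W : Finset V}

/-- W is chosen from the family C alone, before any rearrangement is fixed, so it serves all pairs
of ends that share C. The summand 2 pays for excluding u and v as pivots. -/
lemma InjSegments.exists_expandsInto [Fintype V] (hg : InjSegments g s m) (hC : C ⊆ Finset.range m)
    (hG : G.JoinedAbove t) (hcard : 16 * t + 2 ≤ C.card * (s - 2)) :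
    ∃ W, ExpandsInto G g s u v C W t := by
  obtain ⟨W, h1, h2⟩ := exists_expanding_set hG (hg.injOn (u := u) (v := v) hC)
    (hg.injOn_pred hC) (hg.injOn_succ hC) (by have := hg.le_card_pivots (u := u) (v := v) hC; omega)
  exact ⟨W, h1, h2⟩

lemma ExpandsInto.exists_adj (h : ExpandsInto G g s u v C W t) (hg : InjSegments g s m)
    (hC : C ⊆ Finset.range m) (hG : G.JoinedAbove t) {A : Finset V} (hA : 3 * t ≤ A.card) :
    ∃ a ∈ A, ∃ i ∈ pivotsIn g s u v C W, G.Adj a (g i.1 i.2) := by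
  obtain ⟨a, ha, b, hb, hab⟩ := hG.exists_adj (A := A)
    (B := (pivotsIn g s u v C W).image (fun i : ℕ × ℕ => g i.1 i.2)) (by omega) (by
      rw [Finset.card_image_of_injOn ((hg.injOn (u := u) (v := v) hC).mono
        (Finset.coe_subset.2 (show pivotsIn g s u v C W ⊆ _ from Finset.filter_subset _ _)))]
      have := h.le_card
      omega)
  obtain ⟨i, hi, rfl⟩ := Finset.mem_image.1 hb
  exact ⟨a, ha, i, hi, hab⟩

lemma ExpandsInto.exists_many_heads [Fintype V] (h : ExpandsInto G g s u v C W t) (hGR : G ≤ R)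
    (hg : InjSegments g s m) (hC : C ⊆ Finset.range m) {l : List V} (hc : l.IsChain R.Adj)
    (hn : l.Nodup) (hedge : ∀ j ∈ C, ∀ r, r + 1 < s → s(g j r, g j (r + 1)) ∈ linkEdges l)
    {x : V} (hx : l.head? = some x) {i : ℕ × ℕ} (hi : i ∈ pivotsIn g s u v C W)
    (hadj : G.Adj x (g i.1 i.2)) :
    ∃ X : Finset V, t < X.card ∧
      ∀ x ∈ X, ∃ l', Rearranges R u v l X l' ∧ l'.head? = some x := by
  have hsub : pivotsIn g s u v C W ⊆ pivots g s u v C := Finset.filter_subset _ _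
  have hpiv := fun i (hi : i ∈ pivotsIn g s u v C W) => mem_pivots.1 (hsub hi)
  refine SimpleGraph.exists_many_heads hGR hc hn hx (I := pivotsIn g s u v C W)
    (e := fun i : ℕ × ℕ => g i.1 i.2) (p := fun i => g i.1 (i.2 - 1))
    (q := fun i => g i.1 (i.2 + 1)) ((hg.injOn hC).mono (Finset.coe_subset.2 hsub))
    ((hg.injOn_pred hC).mono (Finset.coe_subset.2 hsub))
    ((hg.injOn_succ hC).mono (Finset.coe_subset.2 hsub)) ?_ ?_ ?_
    (fun i hi => (hpiv i hi).2.2.2.1) (fun i hi => (hpiv i hi).2.2.2.2) (W := W)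
    (fun i hi => (Finset.mem_filter.1 hi).2.1) (fun i hi => (Finset.mem_filter.1 hi).2.2)
    h.expand hi hadj
  · intro i hi heq
    have h1 := hpiv i hi
    have hm := Finset.mem_range.1 (hC h1.1)
    have := (hg _ hm _ hm _ (by omega) _ (by omega) heq).2
    omega
  · intro i hi
    have h1 := hpiv i hi
    have := hedge i.1 h1.1 (i.2 - 1) (by omega)
    rwa [Nat.sub_add_cancel h1.2.1] at this
  · intro i hi
    have h1 := hpiv i hi
    have := hedge i.1 h1.1 i.2 (by omega)
    rwa [Sym2.eq_swap]

end Segments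

/-! ### Closing the path. -/

/-- Large sets of heads at both ends of a path are joined by an edge, which closes the path. -/
lemma JoinedAbove.exists_closed {G R : SimpleGraph V} {u v : V} {t : ℕ} (hG : G.JoinedAbove t)
    {L Q : List V}
    (hc : (L ++ Q).IsChain R.Adj) (hn : (L ++ Q).Nodup) (huv : s(u, v) ∈ linkEdges (L ++ Q))
    {X Y : Finset V} (hXt : t < X.card) (hYt : t < Y.card)
    (hX : ∀ x ∈ X, ∃ l', Rearranges R u v L X l' ∧ l'.head? = some x)
    (hY : ∀ y ∈ Y, ∃ l', Rearranges R u v Q.reverse Y l' ∧ l'.head? = some y) :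
    ∃ c x y, c.Perm (L ++ Q) ∧ c.IsChain R.Adj ∧ s(u, v) ∈ linkEdges c ∧ c.head? = some x ∧
      c.getLast? = some y ∧ G.Adj y x := by
  have hn' := List.nodup_append.1 hn
  have hdis : Disjoint X Y := by
    rw [Finset.disjoint_left]
    intro a ha ha'
    obtain ⟨l₁, h₁, hh₁⟩ := hX a ha
    obtain ⟨l₂, h₂, hh₂⟩ := hY a ha'
    have i1 : a ∈ L := h₁.perm.mem_iff.1 (List.mem_of_mem_head? hh₁)
    have i2 : a ∈ Q := by simpa using h₂.perm.mem_iff.1 (List.mem_of_mem_head? hh₂)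
    exact hn'.2.2 a i1 a i2 rfl
  obtain ⟨x, hx, y, hy, hxy⟩ := hG X Y hdis hXt.le hYt.le
  obtain ⟨l₁, h₁, hh₁⟩ := hX x hx
  obtain ⟨l₂, h₂, hh₂⟩ := hY y hy
  have hL : L ≠ [] := by
    rintro rfl
    have := h₁.perm.eq_nil
    simp [this] at hh₁
  have hQ : Q ≠ [] := by
    rintro rfl
    have := h₂.perm.eq_nil
    simp [this] at hh₂
  obtain ⟨z, hz⟩ := Option.ne_none_iff_exists'.1 (mt List.getLast?_eq_none_iff.1 hL)
  obtain ⟨w, hw⟩ := Option.ne_none_iff_exists'.1 (mt List.head?_eq_none_iff.1 hQ)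
  have hz' : l₁.getLast? = some z := h₁.last.trans hz
  have hw' : l₂.reverse.head? = some w := by
    rw [List.head?_reverse, h₂.last, List.getLast?_reverse, hw]
  refine ⟨l₁ ++ l₂.reverse, x, y, ?_, ?_, ?_, ?_, ?_, hxy.symm⟩
  · exact h₁.perm.append ((List.reverse_perm _).trans (h₂.perm.trans (List.reverse_perm _)))
  · rw [List.isChain_append] at hc ⊢
    refine ⟨h₁.chain, ?_, ?_⟩
    · rw [List.isChain_reverse]
      simpa only [R.adj_comm] using h₂.chain
    · rw [hz', hw']
      rw [hz, hw] at hc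
      exact hc.2.2
  · rw [mem_linkEdges_append_iff hz hw] at huv
    rw [mem_linkEdges_append_iff hz' hw', linkEdges_reverse, List.mem_reverse]
    rcases huv with h | h | h
    · exact Or.inl (h₁.keep h)
    · exact Or.inr (Or.inl h)
    · exact Or.inr (Or.inr (h₂.keep (by rw [linkEdges_reverse]; simpa using h)))
  · rw [List.head?_append, hh₁]; rfl
  · rw [List.getLast?_append, List.getLast?_reverse, hh₂]; rfl

/-- A lost edge breaks at most the block containing its earlier endpoint, whose number is the
position divided by s. -/
lemma card_unbroken_segments [DecidableEq V] {l l' : List V} (hn : l.Nodup) (a : V) {s m : ℕ}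
    (hs : 1 ≤ s) (hms : m * s ≤ l.length) :
    ∃ J ⊆ Finset.range m, m ≤ J.card + lostCard l l' ∧
      ∀ j ∈ J, ∀ r, r + 1 < s →
        s(l.getD (j * s + r) a, l.getD (j * s + (r + 1)) a) ∈ linkEdges l' := by
  classical
  let f : ℕ → V := fun i => l.getD i a
  let K : Finset ℕ := (Finset.range (l.length - 1)).filter
    (fun i => s(f i, f (i + 1)) ∉ linkEdges l')
  have hK : K.card ≤ lostCard l l' := by
    unfold lostCard
    apply Finset.card_le_card_of_injOn (fun i => s(f i, f (i + 1)))
    · intro i hi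
      obtain ⟨h1, h2⟩ := Finset.mem_filter.1 (Finset.mem_coe.1 hi)
      rw [Finset.mem_range] at h1
      simp only [Finset.coe_sdiff, Set.mem_sdiff, Finset.mem_coe, List.mem_toFinset]
      exact ⟨mem_linkEdges_getD l a (by omega), h2⟩
    · intro i hi j hj hij
      have h1 := Finset.mem_range.1 (Finset.mem_filter.1 (Finset.mem_coe.1 hi)).1
      have h2 := Finset.mem_range.1 (Finset.mem_filter.1 (Finset.mem_coe.1 hj)).1
      have hf := injOn_getD hn a
      rcases Sym2.eq_iff.1 hij with ⟨h3, _⟩ | ⟨h3, h4⟩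
      · exact hf (show i < _ by omega) (show j < _ by omega) h3
      · have := hf (show i < _ by omega) (show j + 1 < _ by omega) h3
        have := hf (show i + 1 < _ by omega) (show j < _ by omega) h4
        omega
  refine ⟨Finset.range m \ K.image (fun i => i / s), Finset.sdiff_subset, ?_, ?_⟩
  · have h1 := Finset.le_card_sdiff (K.image (fun i => i / s)) (Finset.range m)
    have h2 : (K.image (fun i => i / s)).card ≤ K.card := Finset.card_image_le
    rw [Finset.card_range] at h1
    omega
  · intro j hj r hr
    obtain ⟨h1, h2⟩ := Finset.mem_sdiff.1 hj
    rw [Finset.mem_range] at h1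
    by_contra hcon
    apply h2
    refine Finset.mem_image.2 ⟨j * s + r, Finset.mem_filter.2 ⟨?_, hcon⟩, ?_⟩
    · rw [Finset.mem_range]
      have : (j + 1) * s ≤ m * s := Nat.mul_le_mul_right _ h1
      rw [add_mul] at this
      omega
    · rw [mul_comm, Nat.mul_add_div (by omega), Nat.div_eq_of_lt (by omega), add_zero]

lemma injSegments_getD {l : List V} (hn : l.Nodup) (a : V) {s m : ℕ} (hms : m * s ≤ l.length) :
    InjSegments (fun j r => l.getD (j * s + r) a) s m := by
  intro j hj j' hj' r hr r' hr' h
  have h1 : (j + 1) * s ≤ m * s := Nat.mul_le_mul_right _ hj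
  have h2 : (j' + 1) * s ≤ m * s := Nat.mul_le_mul_right _ hj'
  rw [add_mul] at h1 h2
  have h3 := injOn_getD hn a (show j * s + r < _ by omega) (show j' * s + r' < _ by omega) h
  have h4 : (j * s + r) / s = j := by
    rw [mul_comm, Nat.mul_add_div (by omega), Nat.div_eq_of_lt (by omega), add_zero]
  have h5 : (j' * s + r') / s = j' := by
    rw [mul_comm, Nat.mul_add_div (by omega), Nat.div_eq_of_lt (by omega), add_zero]
  have h6 : j = j' := by rw [← h4, ← h5, h3]
  subst h6
  exact ⟨rfl, by omega⟩

/-- The vertices with many partners in a large set of pairs are numerous. -/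
lemma exists_many_partners [Fintype V] [DecidableEq V] (P : Finset (Σ _ : V, V)) {t : ℕ}
    (hP : 6 * t * Fintype.card V < P.card) :
    ∃ A : Finset V, 3 * t ≤ A.card ∧
      ∀ a ∈ A, ∃ B : Finset V, 3 * t ≤ B.card ∧ ∀ b ∈ B, (⟨a, b⟩ : Σ _ : V, V) ∈ P := by
  let B : V → Finset V := fun a => Finset.univ.filter (fun b => (⟨a, b⟩ : Σ _ : V, V) ∈ P)
  let A : Finset V := Finset.univ.filter (fun a => 3 * t ≤ (B a).card)
  refine ⟨A, ?_, fun a ha => ⟨B a, (Finset.mem_filter.1 ha).2, fun b hb =>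
    (Finset.mem_filter.1 hb).2⟩⟩
  by_contra! hcon
  have h1 : P ⊆ Finset.univ.sigma B := by
    rintro ⟨a, b⟩ h
    simpa [B] using h
  have h2 := Finset.card_le_card h1
  rw [Finset.card_sigma, ← Finset.sum_filter_add_sum_filter_not _ (fun a => 3 * t ≤ (B a).card)]
    at h2
  have h3 : ∑ a with 3 * t ≤ (B a).card, (B a).card ≤ A.card * Fintype.card V := by
    rw [← smul_eq_mul]
    exact Finset.sum_le_card_nsmul _ _ _ (fun a _ => Finset.card_le_univ _)
  have h4 : ∑ a with ¬ 3 * t ≤ (B a).card, (B a).card ≤ Fintype.card V * (3 * t) := by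
    refine (Finset.sum_le_card_nsmul _ _ (3 * t) (fun a ha => ?_)).trans ?_
    · have := (Finset.mem_filter.1 ha).2
      omega
    · rw [smul_eq_mul]
      exact Nat.mul_le_mul_right _ (Finset.card_le_univ _)
  have h5 : A.card * Fintype.card V ≤ 3 * t * Fintype.card V := Nat.mul_le_mul_right _ hcon.le
  nlinarith

/-- `l'` is a rearrangement of the path `l` from `b` to `a` through the edge `uv` that has lost at
most `k` edges of `l`. -/
def IsRearrangementBetween [DecidableEq V] (R : SimpleGraph V) (u v : V) (l : List V) (k : ℕ)
    (a b : V) (l' : List V) : Prop :=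
  l'.Perm l ∧ l'.IsChain R.Adj ∧ s(u, v) ∈ linkEdges l' ∧ l'.head? = some b ∧
    l'.getLast? = some a ∧ lostCard l l' ≤ k

section Closing

variable [Fintype V] [DecidableEq V] {G R : SimpleGraph V} {u v : V} {l : List V} {d : ℝ}
  {M r t : ℕ}

/-- The growth argument is run twice: once at the first vertex, then on the reversal of each
resulting path. Unextendability passes on because it concerns all rearrangements of l at once. -/
lemma exists_many_pairs (hGR : G ≤ R) (hc : l.IsChain R.Adj) (hn : l.Nodup)
    (huv : s(u, v) ∈ linkEdges l) (hmax : IsUnextendable G R u v l) (hd : 12 ≤ d) (hr3 : 3 ≤ r)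
    (hr : (4 * r : ℝ) ≤ d) (hP : G.ExpandsUpTo d M) (hG : G.JoinedAbove t) (hM : 1 ≤ M)
    (ht : 1 ≤ t) (hMt : (16 * t : ℝ) ≤ d * M) (hcard : 15 * t + 23 * M + 9 ≤ Fintype.card V)
    {K : ℕ} (hK : M < r ^ K) :
    ∃ P : Finset (Σ _ : V, V), Fintype.card V * Fintype.card V ≤ 9 * P.card ∧
      ∀ p ∈ P, ∃ l', IsRearrangementBetween R u v l (2 * (K + 2)) p.1 p.2 l' := by
  obtain ⟨B, hB, hBl⟩ := exists_many_rearrangements hGR hc hn huv hmax hd hr3 hr hP hG hM ht hMt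
    hcard hK
  have hex : ∀ a ∈ B, ∃ B' : Finset V, Fintype.card V ≤ 3 * B'.card ∧ ∀ b ∈ B', ∃ l',
      IsRearrangementBetween R u v l (2 * (K + 2)) a b l' := by
    intro a ha
    obtain ⟨l₁, h₁, hh₁, hk₁⟩ := hBl a ha
    have hp : l₁.reverse.Perm l := (List.reverse_perm _).trans h₁.perm
    obtain ⟨B', hB', hBl'⟩ := exists_many_rearrangements (l := l₁.reverse) (R := R) (u := u)
      (v := v) hGR
      (by
        rw [List.isChain_reverse]
        simpa only [R.adj_comm] using h₁.chain)
      (hp.nodup_iff.2 hn) (by rw [linkEdges_reverse, List.mem_reverse]; exact h₁.keep huv)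
      (fun l' hl' hc' huv' x hx y hxy => hp.mem_iff.2 (hmax l' (hl'.trans hp) hc' huv' x hx y hxy))
      hd hr3 hr hP hG hM ht hMt hcard hK
    refine ⟨B', hB', fun b hb => ?_⟩
    obtain ⟨l₂, h₂, hh₂, hk₂⟩ := hBl' b hb
    refine ⟨l₂, h₂.perm.trans hp, h₂.chain, ?_, hh₂, ?_, ?_⟩
    · exact h₂.keep (by rw [linkEdges_reverse, List.mem_reverse]; exact h₁.keep huv)
    · rw [h₂.last, List.getLast?_reverse, hh₁]
    · have := lostCard_le_add l l₁ l₂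
      rw [lostCard_reverse_left] at hk₂
      omega
  choose! Bf hBf hBf' using hex
  refine ⟨B.sigma Bf, ?_, ?_⟩
  · rw [Finset.card_sigma]
    have h1 : B.card * Fintype.card V ≤ ∑ a ∈ B, 3 * (Bf a).card := by
      rw [← smul_eq_mul]
      exact Finset.card_nsmul_le_sum _ _ _ hBf
    rw [← Finset.mul_sum] at h1
    have h2 : Fintype.card V * Fintype.card V ≤ 3 * B.card * Fintype.card V :=
      Nat.mul_le_mul_right _ hB
    nlinarith
  · rintro ⟨a, b⟩ hp
    obtain ⟨h1, h2⟩ := Finset.mem_sigma.1 hp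
    exact hBf' a h1 b h2

/-- A longest path through `uv` can be rearranged into one whose ends are adjacent. -/
lemma exists_closed_rearrangement (hGR : G ≤ R) (hc : l.IsChain R.Adj) (hn : l.Nodup)
    (huv : s(u, v) ∈ linkEdges l) (hmax : IsUnextendable G R u v l) (hd : 12 ≤ d) (hr3 : 3 ≤ r)
    (hr : (4 * r : ℝ) ≤ d) (hP : G.ExpandsUpTo d M) (hG : G.JoinedAbove t) (hM : 1 ≤ M)
    (ht : 1 ≤ t) (hMt : (16 * t : ℝ) ≤ d * M) (hcard : 15 * t + 23 * M + 9 ≤ Fintype.card V)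
    {K : ℕ} (hK : M < r ^ K) {h s : ℕ} (hh : 3 * h ≤ K + 5) (hs : 12 * (K + 2) * s ≤ Fintype.card V)
    (hst : 16 * t + 2 ≤ h * (s - 2)) (hbig : 54 * 36 ^ h * t < Fintype.card V) :
    ∃ c x y, c.Perm l ∧ c.IsChain R.Adj ∧ s(u, v) ∈ linkEdges c ∧ c.head? = some x ∧
      c.getLast? = some y ∧ G.Adj y x := by
  classical
  have hs1 : 1 ≤ s := by
    by_contra hcon
    have : s = 0 := by omega
    subst this
    simp at hst
  obtain ⟨P, hPcard, hPl⟩ := exists_many_pairs hGR hc hn huv hmax hd hr3 hr hP hG hM ht hMt hcard hK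
  choose! lp hlp using hPl
  have hlen : Fintype.card V ≤ 3 * l.length := by
    obtain ⟨B, hB, hBl⟩ := exists_many_rearrangements hGR hc hn huv hmax hd hr3 hr hP hG hM ht hMt
      hcard hK
    have hsub : B ⊆ l.toFinset := by
      intro x hx
      obtain ⟨l', h1, h2, _⟩ := hBl x hx
      exact List.mem_toFinset.2 (h1.perm.mem_iff.1 (List.mem_of_mem_head? h2))
    have h1 := Finset.card_le_card hsub
    have h2 := List.toFinset_card_le l
    omega
  -- At most 2(K + 2) edges are lost, so at least half of 4(K + 2) segments stay unbroken, enough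
  -- for K + 2 on each side of a cut.
  obtain ⟨m, hm⟩ : ∃ m, m = 4 * (K + 2) := ⟨_, rfl⟩
  have hms : m * s ≤ l.length := by
    have : 12 * (K + 2) * s = 3 * (m * s) := by rw [hm]; ring
    omega
  let g : ℕ → ℕ → V := fun j r => l.getD (j * s + r) u
  have hg : InjSegments g s m := injSegments_getD hn u hms
  have hcut : ∀ p ∈ P, ∃ L Q J, J ⊆ Finset.range m ∧ lp p = L ++ Q ∧
      (∀ j ∈ J, ∀ r, r + 1 < s → s(g j r, g j (r + 1)) ∈ linkEdges (lp p)) ∧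
      K + 2 ≤ (segmentsIn g s J L).card ∧ K + 2 ≤ (segmentsIn g s J Q).card := by
    intro p hp
    obtain ⟨hp1, hp2, hp3, hp4, hp5, hp6⟩ := hlp p hp
    obtain ⟨J, hJ, hJc, hJe⟩ := card_unbroken_segments (l' := lp p) hn u hs1 hms
    obtain ⟨L, Q, hLQ, h1, h2⟩ := exists_cut (l := lp p) (hp1.nodup_iff.2 hn) (g := g) hs1 (J := J)
      (fun j hj j' hj' r hr r' hr' h => (hg j (Finset.mem_range.1 (hJ hj)) j'
        (Finset.mem_range.1 (hJ hj')) r hr r' hr' h).1)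
      (fun j hj r hr => by
        apply hp1.mem_iff.2
        have h1 : (j + 1) * s ≤ m * s := Nat.mul_le_mul_right _ (Finset.mem_range.1 (hJ hj))
        rw [add_mul] at h1
        have h2 : j * s + r < l.length := by omega
        simp only [g]
        rw [List.getD_eq_getElem _ _ h2]
        exact List.getElem_mem h2)
      hJe (k := K + 2) (by omega) (by omega)
    exact ⟨L, Q, J, hJ, hLQ, hJe, h1, h2⟩
  choose! L Q J hJ hLQ hJe hL hQ using hcut
  -- The condition 4(K + 2) ≤ 6(K + 3 - h) for averaging is what `hh` provides.
  obtain ⟨C₁, hC₁, hC₁h, P₁, hP₁, hPC₁, hP₁c⟩ := exists_common_subset P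
    (fun p => segmentsIn g s (J p) (L p)) (m := m) (g := K + 2) (h := h)
    (fun p hp => (segmentsIn_subset _ _ _ _).trans (hJ p hp)) hL (by omega) (by omega)
  obtain ⟨C₂, hC₂, hC₂h, P₂, hP₂, hPC₂, hP₂c⟩ := exists_common_subset P₁
    (fun p => segmentsIn g s (J p) (Q p)) (m := m) (g := K + 2) (h := h)
    (fun p hp => (segmentsIn_subset _ _ _ _).trans (hJ p (hP₁ hp))) (fun p hp => hQ p (hP₁ hp))
    (by omega) (by omega)
  obtain ⟨W₁, hW₁⟩ := hg.exists_expandsInto (u := u) (v := v) hC₁ hG (by rw [hC₁h]; exact hst)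
  obtain ⟨W₂, hW₂⟩ := hg.exists_expandsInto (u := u) (v := v) hC₂ hG (by rw [hC₂h]; exact hst)
  -- Since n² ≤ 9 · 36^h |P₂|, having |P₂| ≤ 6tn would contradict `hbig`.
  obtain ⟨A, hA, hAB⟩ := exists_many_partners P₂ (t := t) (by
    have h1 : P.card ≤ P₂.card * 36 ^ h := by
      calc P.card ≤ P₁.card * 6 ^ h := hP₁c
        _ ≤ (P₂.card * 6 ^ h) * 6 ^ h := Nat.mul_le_mul_right _ hP₂c
        _ = _ := by rw [mul_assoc, ← mul_pow]; norm_num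
    by_contra! hcon
    have h2 : P₂.card * 36 ^ h ≤ 6 * t * Fintype.card V * 36 ^ h := Nat.mul_le_mul_right _ hcon
    have h3 : 54 * 36 ^ h * t * Fintype.card V < Fintype.card V * Fintype.card V :=
      Nat.mul_lt_mul_of_pos_right hbig (by omega)
    nlinarith)
  -- The last vertex a is fixed first, adjacent to a pivot of the right family. The head b is then
  -- found among the partners of a, adjacent to a pivot of the left family.
  obtain ⟨a, ha, i₂, hi₂, hadj₂⟩ := hW₂.exists_adj hg hC₂ hG hA
  obtain ⟨B, hB, hBP⟩ := hAB a ha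
  obtain ⟨b, hb, i₁, hi₁, hadj₁⟩ := hW₁.exists_adj hg hC₁ hG hB
  have hp₂ := hBP b hb
  have hp₁ := hP₂ hp₂
  have hp := hP₁ hp₁
  obtain ⟨q1, q2, q3, q4, q5, _⟩ := hlp _ hp
  have hnp : (lp ⟨a, b⟩).Nodup := q1.nodup_iff.2 hn
  have hJe' := hJe _ hp
  rw [hLQ _ hp] at q1 q2 q3 q4 q5 hnp hJe'
  have hc' := List.isChain_append.1 q2
  have hi₁' := mem_pivots.1 (Finset.filter_subset _ _ hi₁)
  have hi₂' := mem_pivots.1 (Finset.filter_subset _ _ hi₂)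
  have hmem₁ : ∀ j ∈ C₁, j ∈ J ⟨a, b⟩ ∧ ∀ r < s, g j r ∈ L ⟨a, b⟩ :=
    fun j hj => mem_segmentsIn.1 (hPC₁ _ hp₁ hj)
  have hmem₂ : ∀ j ∈ C₂, j ∈ J ⟨a, b⟩ ∧ ∀ r < s, g j r ∈ Q ⟨a, b⟩ :=
    fun j hj => mem_segmentsIn.1 (hPC₂ _ hp₂ hj)
  have hLne : L ⟨a, b⟩ ≠ [] := List.ne_nil_of_mem ((hmem₁ _ hi₁'.1).2 i₁.2 (by omega))
  have hQne : Q ⟨a, b⟩ ≠ [] := List.ne_nil_of_mem ((hmem₂ _ hi₂'.1).2 i₂.2 (by omega))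
  rw [List.head?_append_of_ne_nil _ hLne] at q4
  rw [List.getLast?_append_of_ne_nil _ hQne] at q5
  have hn' := List.nodup_append.1 hnp
  obtain ⟨X, hXt, hX⟩ := hW₁.exists_many_heads hGR hg hC₁ hc'.1 hn'.1
    (fun j hj r hr => mem_linkEdges_left hnp (hJe' j (hmem₁ j hj).1 r hr)
      ((hmem₁ j hj).2 _ (by omega)) ((hmem₁ j hj).2 _ hr)) q4 hi₁ hadj₁
  obtain ⟨Y, hYt, hY⟩ := hW₂.exists_many_heads hGR hg hC₂ (l := (Q ⟨a, b⟩).reverse)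
    (by
      rw [List.isChain_reverse]
      simpa only [R.adj_comm] using hc'.2.1)
    (List.nodup_reverse.2 hn'.2.1)
    (fun j hj r hr => by
      rw [linkEdges_reverse, List.mem_reverse]
      exact mem_linkEdges_right hnp (hJe' j (hmem₂ j hj).1 r hr)
        ((hmem₂ j hj).2 _ (by omega)) ((hmem₂ j hj).2 _ hr))
    (by rw [List.head?_reverse, q5]) hi₂ hadj₂
  obtain ⟨c, x, y, h1, h2⟩ := hG.exists_closed q2 hnp q3 hXt hYt hX hY
  exact ⟨c, x, y, h1.trans q1, h2⟩

end Closing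

/-! ### From a closed longest path to a Hamilton path. -/

lemma exists_isHamiltonian_of_list [DecidableEq V] {G : SimpleGraph V} {l : List V} {a b : V}
    (hc : l.IsChain G.Adj) (hn : l.Nodup) (ha : l.head? = some a) (hb : l.getLast? = some b)
    (hl : ∀ w, w ∈ l) : ∃ p : G.Walk a b, p.IsHamiltonian := by
  have hne : l ≠ [] := List.ne_nil_of_mem (hl a)
  have ha' : l.head hne = a := by
    rw [List.head?_eq_some_head hne] at ha
    exact Option.some.inj ha
  have hb' : l.getLast hne = b := by
    rw [List.getLast?_eq_some_getLast hne] at hb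
    exact Option.some.inj hb
  subst ha' hb'
  refine ⟨Walk.ofSupport l hne hc, fun w => ?_⟩
  rw [Walk.support_ofSupport]
  exact List.count_eq_one_of_mem hn (hl w)

lemma Walk.IsHamiltonian.exists_isHamiltonianCycle_cons [Fintype V] [DecidableEq V]
    {G : SimpleGraph V} {a b : V} {p : G.Walk b a} (hp : p.IsHamiltonian) (h : G.Adj a b)
    (hV : 3 ≤ Fintype.card V) : (Walk.cons h p).IsHamiltonianCycle := by
  have hlen := hp.length_eq
  rw [Walk.isHamiltonianCycle_iff_isCycle_and_length_eq, Walk.cons_isCycle_iff, Walk.length_cons]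
  refine ⟨⟨hp.isPath, ?_⟩, by omega⟩
  have hpath := hp.isPath
  cases p with
  | nil => simp at hlen; omega
  | @cons _ c _ hbc q =>
    rw [Walk.cons_isPath_iff] at hpath
    rw [Walk.edges_cons, List.mem_cons]
    rintro (heq | hmem)
    · have hac : a = c := by
        rcases Sym2.eq_iff.1 heq with ⟨h1, _⟩ | ⟨h1, _⟩
        · exact absurd h1 h.ne
        · exact h1
      subst hac
      have := Walk.length_eq_zero_iff.2 (Walk.isPath_iff_nil.1 hpath.1)
      rw [Walk.length_cons] at hlen
      omega
    · exact hpath.2 (Walk.snd_mem_support_of_mem_edges _ hmem)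

/-- With no edge leaving S, the neighbourhood of a subset of size min(|S|, M) would stay inside S,
and S is too small for that. -/
lemma ExpandsUpTo.exists_adj_of_card_lt [Fintype V] [DecidableEq V] {G : SimpleGraph V} {d : ℝ}
    {M t : ℕ} (hP : G.ExpandsUpTo d M) (hd : 12 ≤ d) (hMt : (16 * t : ℝ) ≤ d * M) {S : Finset V}
    (hS : S.Nonempty) (hSt : S.card < t) : ∃ a ∈ S, ∃ b ∉ S, G.Adj a b := by
  by_contra! hcon
  obtain ⟨S', hS', hc⟩ := Finset.exists_subset_card_eq (Nat.min_le_left S.card M)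
  have h1 := hP S' (hc ▸ Nat.min_le_right _ _)
  have h2 : G.externalNeighborhood S' ⊆ S \ S' := by
    intro y hy
    obtain ⟨hy1, x, hx, hxy⟩ := mem_externalNeighborhood.1 hy
    rw [Finset.mem_sdiff]
    refine ⟨?_, hy1⟩
    by_contra hyS
    exact hcon x (hS' hx) y hyS hxy
  have h3 := Finset.card_le_card h2
  rw [Finset.card_sdiff_of_subset hS'] at h3
  have hpos := hS.card_pos
  rcases le_total S.card M with hle | hle
  · rw [min_eq_left hle] at hc
    have h4 : (G.externalNeighborhood S').card = 0 := by omega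
    rw [h4, hc] at h1
    have : (0 : ℝ) < S.card := by exact_mod_cast hpos
    norm_num at h1
    nlinarith
  · rw [min_eq_right hle] at hc
    have h4 : ((G.externalNeighborhood S').card : ℝ) ≤ S.card := by
      exact_mod_cast h3.trans (Nat.sub_le _ _)
    have h5 : (S.card : ℝ) < t := by exact_mod_cast hSt
    have h6 : (0 : ℝ) < t := by linarith [(Nat.cast_nonneg S.card : (0 : ℝ) ≤ S.card)]
    rw [hc] at h1
    linarith

lemma ExpandsUpTo.exists_adj_boundary [Fintype V] [DecidableEq V] {G : SimpleGraph V} {d : ℝ}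
    {M t : ℕ} (hP : G.ExpandsUpTo d M) (hG : G.JoinedAbove t) (hd : 12 ≤ d)
    (hMt : (16 * t : ℝ) ≤ d * M) {S : Finset V} (hS : S.Nonempty) (hS' : Sᶜ.Nonempty) :
    ∃ a ∈ S, ∃ b ∉ S, G.Adj a b := by
  rcases lt_or_ge S.card t with h | h
  · exact hP.exists_adj_of_card_lt hd hMt hS h
  rcases lt_or_ge Sᶜ.card t with h' | h'
  · obtain ⟨a, ha, b, hb, hab⟩ := hP.exists_adj_of_card_lt hd hMt hS' h'
    exact ⟨b, by simpa using hb, a, by simpa using ha, hab.symm⟩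
  · obtain ⟨a, ha, b, hb, hab⟩ := hG S Sᶜ disjoint_compl_right h h'
    exact ⟨a, ha, b, by simpa using hb, hab⟩

/-- Removing the link `uv` from a closed path leaves a path of `G` between `u` and `v`. -/
lemma exists_chain_of_closed {G : SimpleGraph V} {u v : V} {c : List V} {x y : V}
    (hc : c.IsChain (G ⊔ edge u v).Adj) (hn : c.Nodup) (huv : s(u, v) ∈ linkEdges c)
    (hx : c.head? = some x) (hy : c.getLast? = some y) (hyx : G.Adj y x) :
    ∃ (D : List V) (a b : V), D.Perm c ∧ D.IsChain G.Adj ∧ s(a, b) = s(u, v) ∧ D.head? = some a ∧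
      D.getLast? = some b := by
  obtain ⟨A, z, w, B, rfl, he⟩ := exists_eq_append_of_mem_linkEdges huv
  have hA : A ++ z :: w :: B = (A ++ [z]) ++ (w :: B) := by simp
  rw [hA] at hc hn hx hy ⊢
  have hn' := List.nodup_append.1 hn
  have hc' := List.isChain_append.1 hc
  refine ⟨(w :: B) ++ (A ++ [z]), w, z, List.perm_append_comm, ?_, ?_, by simp,
    by rw [List.getLast?_append_of_ne_nil _ (by simp)]; simp⟩
  · have hG : ∀ {l : List V} {m : V}, (m = w ∨ m = z) → m ∉ l → l.IsChain (G ⊔ edge u v).Adj →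
        l.IsChain G.Adj := by
      intro l m hm hml hl
      refine List.IsChain.imp_of_mem_imp ?_ hl
      intro a b ha hb hab
      rw [sup_adj, adj_edge] at hab
      refine hab.resolve_right ?_
      rintro ⟨h1, _⟩
      have h2 : m ∈ s(a, b) := by rw [← h1, he]; rcases hm with rfl | rfl <;> simp
      rcases Sym2.mem_iff.1 h2 with rfl | rfl
      · exact hml ha
      · exact hml hb
    rw [List.isChain_append]
    refine ⟨hG (m := z) (Or.inr rfl) ?_ hc'.2.1, hG (m := w) (Or.inl rfl) ?_ hc'.1, ?_⟩
    · intro hz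
      exact hn'.2.2 z (by simp) z hz rfl
    · intro hw
      exact hn'.2.2 w hw w (by simp) rfl
    · intro a ha b hb
      rw [List.head?_append_of_ne_nil _ (by simp)] at hx
      rw [List.getLast?_append_of_ne_nil _ (by simp)] at hy
      rw [Option.mem_def, hy] at ha
      rw [Option.mem_def, hx] at hb
      cases ha
      cases hb
      exact hyx
  · rw [he, Sym2.eq_swap]

/-- A path of `G` between `u` and `v` can be prolonged, through the link `uv`, by any further vertex
adjacent to it. -/
lemma exists_longer {G : SimpleGraph V} {u v : V} (huv : u ≠ v) {D : List V} {a b p w : V}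
    (hc : D.IsChain G.Adj) (hn : D.Nodup) (hab : s(a, b) = s(u, v)) (ha : D.head? = some a)
    (hb : D.getLast? = some b) (hp : p ∈ D) (hw : w ∉ D) (hpw : G.Adj p w) :
    ∃ l : List V, l.IsChain (G ⊔ edge u v).Adj ∧ l.Nodup ∧ s(u, v) ∈ linkEdges l ∧
      l.length = D.length + 1 := by
  have hR : (G ⊔ edge u v).Adj a b := by
    rw [sup_adj, adj_edge]
    right
    refine ⟨hab.symm, ?_⟩
    rintro rfl
    rcases Sym2.eq_iff.1 hab with ⟨h1, h2⟩ | ⟨h1, h2⟩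
    · exact huv (h1.symm.trans h2)
    · exact huv (h2.symm.trans h1)
  have hle : ∀ {l : List V}, l.IsChain G.Adj → l.IsChain (G ⊔ edge u v).Adj :=
    fun h => h.imp (fun _ _ h => Or.inl h)
  obtain ⟨D₁, D₂, rfl⟩ := List.append_of_mem hp
  have hc' := List.isChain_append.1 hc
  -- Together with uv, D is a cycle, which is opened next to p. If p is the first vertex, cutting
  -- just before p would remove uv itself, so the cut is made just after p.
  cases D₁ with
  | nil =>
    simp only [List.nil_append, List.head?_cons, Option.some.injEq] at *
    subst ha
    have hD₂ : D₂ ≠ [] := by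
      rintro rfl
      simp at hb
      exact hR.ne hb
    have hb' : D₂.reverse.head? = some b := by
      rw [List.head?_reverse]
      rwa [show p :: D₂ = [p] ++ D₂ from rfl, List.getLast?_append_of_ne_nil _ hD₂] at hb
    refine ⟨[w, p] ++ D₂.reverse, ?_, ?_, ?_, by simp⟩
    · rw [List.isChain_append]
      refine ⟨by simpa using Or.inl hpw.symm, hle ?_, ?_⟩
      · rw [List.isChain_reverse]
        simpa only [G.adj_comm] using hc.of_cons
      · intro c hc d hd
        rw [hb'] at hd
        simp at hc hd
        subst hc hd
        exact hR
    · have : ([w, p] ++ D₂.reverse).Perm (w :: p :: D₂) :=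
        List.Perm.append_left [w, p] (List.reverse_perm D₂)
      exact this.nodup_iff.2 (List.nodup_cons.2 ⟨hw, hn⟩)
    · rw [mem_linkEdges_append_iff (z := p) (y := b) (by simp) hb', hab]
      exact Or.inr (Or.inl rfl)
  | cons a' D₁ =>
    simp only [List.cons_append, List.head?_cons, Option.some.injEq] at ha
    subst ha
    have hb' : (w :: p :: D₂).getLast? = some b := by
      rw [List.getLast?_append_of_ne_nil _ (by simp)] at hb
      rwa [show w :: p :: D₂ = [w] ++ (p :: D₂) from rfl,
        List.getLast?_append_of_ne_nil _ (by simp)]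
    refine ⟨(w :: p :: D₂) ++ (a' :: D₁), ?_, ?_, ?_, by simp; omega⟩
    · rw [List.isChain_append]
      refine ⟨List.isChain_cons_cons.2 ⟨Or.inl hpw.symm, hle hc'.2.1⟩, hle hc'.1, ?_⟩
      intro c hc d hd
      rw [hb'] at hc
      simp at hc hd
      subst hc hd
      exact hR.symm
    · have : ((w :: p :: D₂) ++ (a' :: D₁)).Perm (w :: ((a' :: D₁) ++ p :: D₂)) :=
        List.Perm.cons w List.perm_append_comm
      exact this.nodup_iff.2 (List.nodup_cons.2 ⟨hw, hn⟩)
    · rw [mem_linkEdges_append_iff (z := b) (y := a') hb' (by simp), ← hab, Sym2.eq_swap]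
      exact Or.inr (Or.inl rfl)

lemma exists_longest_chain [Fintype V] (R : SimpleGraph V) {u v : V} (huv : R.Adj u v) :
    ∃ l : List V, l.IsChain R.Adj ∧ l.Nodup ∧ s(u, v) ∈ linkEdges l ∧
      ∀ l' : List V, l'.IsChain R.Adj → l'.Nodup → s(u, v) ∈ linkEdges l' →
        l'.length ≤ l.length := by
  by_contra! hcon
  have : ∀ k : ℕ, ∃ l : List V, l.IsChain R.Adj ∧ l.Nodup ∧ s(u, v) ∈ linkEdges l ∧
      k ≤ l.length := by
    intro k
    induction k with
    | zero => exact ⟨[u, v], by simpa, by simpa using huv.ne, by simp, by simp⟩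
    | succ k ih =>
      obtain ⟨l, h1, h2, h3, h4⟩ := ih
      obtain ⟨l', h1', h2', h3', h4'⟩ := hcon l h1 h2 h3
      exact ⟨l', h1', h2', h3', by omega⟩
  obtain ⟨l, _, h2, _, h4⟩ := this (Fintype.card V + 1)
  have := h2.length_le_card
  omega

/-- Numerical conditions under which expansion makes a graph Hamilton-connected. -/
theorem isHamiltonConnected_of_expands [Fintype V] [DecidableEq V] {G : SimpleGraph V} {d : ℝ}
    {M r t K h s : ℕ} (hd : 12 ≤ d) (hr3 : 3 ≤ r) (hr : (4 * r : ℝ) ≤ d) (hP : G.ExpandsUpTo d M)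
    (hG : G.JoinedAbove t) (hM : 1 ≤ M) (ht : 1 ≤ t) (hMt : (16 * t : ℝ) ≤ d * M)
    (hcard : 15 * t + 23 * M + 9 ≤ Fintype.card V) (hK : M < r ^ K) (hh : 3 * h ≤ K + 5)
    (hs : 12 * (K + 2) * s ≤ Fintype.card V) (hst : 16 * t + 2 ≤ h * (s - 2))
    (hbig : 54 * 36 ^ h * t < Fintype.card V) : G.IsHamiltonConnected := by
  intro u v huv
  obtain ⟨l, hc, hn, hl, hmax⟩ := exists_longest_chain (G ⊔ edge u v) (u := u) (v := v)
    (by rw [sup_adj, adj_edge]; exact Or.inr ⟨rfl, huv⟩)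
  have hun : IsUnextendable G (G ⊔ edge u v) u v l := by
    intro l' hp hc' huv' x hx y hxy
    by_contra hy
    obtain ⟨l₁, rfl⟩ := List.head?_eq_some_iff.1 hx
    have := hmax (y :: x :: l₁) (List.isChain_cons_cons.2 ⟨Or.inl hxy.symm, hc'⟩)
      (List.nodup_cons.2 ⟨fun h => hy (hp.mem_iff.1 h), hp.nodup_iff.2 hn⟩)
      (by rw [linkEdges_cons_cons]; exact List.mem_cons_of_mem _ huv')
    have h2 := hp.length_eq
    simp only [List.length_cons] at this h2
    omega
  obtain ⟨c, x, y, hcl, hcc, huvc, hx, hy, hyx⟩ := exists_closed_rearrangement le_sup_left hc hn hl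
    hun hd hr3 hr hP hG hM ht hMt hcard hK hh hs hst hbig
  have hnc := hcl.nodup_iff.2 hn
  obtain ⟨D, a, b, hDc, hD, hab, ha, hb⟩ := exists_chain_of_closed hcc hnc huvc hx hy hyx
  have hnD := hDc.nodup_iff.2 hnc
  have hall : ∀ w, w ∈ D := by
    by_contra! hcon
    obtain ⟨w, hw⟩ := hcon
    obtain ⟨p, hp, q, hq, hpq⟩ := hP.exists_adj_boundary hG hd hMt (S := D.toFinset)
      ⟨a, by simpa using List.mem_of_mem_head? ha⟩ ⟨w, by simpa using hw⟩
    obtain ⟨l', h1, h2, h3, h4⟩ := exists_longer huv hD hnD hab ha hb (by simpa using hp)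
      (by simpa using hq) hpq
    have h5 := hmax l' h1 h2 h3
    have h6 := hDc.length_eq
    have h7 := hcl.length_eq
    omega
  rcases Sym2.eq_iff.1 hab with ⟨rfl, rfl⟩ | ⟨rfl, rfl⟩
  · exact exists_isHamiltonian_of_list hD hnD ha hb hall
  · refine exists_isHamiltonian_of_list (l := D.reverse) ?_ (List.nodup_reverse.2 hnD) ?_ ?_
      (by simpa using hall)
    · rw [List.isChain_reverse]
      simpa only [G.adj_comm] using hD
    · rw [List.head?_reverse, hb]
    · rw [List.getLast?_reverse, ha]

/-! ### Asymptotics and choice of parameters. -/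

open Filter Topology

/-- Here a stands for log log n. Since 36^(a / log a) is e^(o(a)), the product costs only e^(2a/3).
The factor e^(a/3) is the cube root of log n, the bound available for log d. -/
lemma eventually_log_bounds : ∀ᶠ a : ℝ in atTop, 1 ≤ Real.log a ∧ 4130 ≤ a / Real.log a ∧
    (36 : ℝ) ^ (a / Real.log a) * (a / Real.log a) * Real.exp (a / 3) ≤ Real.exp a ∧
    20 ≤ a := by
  have h1 : ∀ᶠ a : ℝ in atTop, 6 * Real.log 36 + 1 ≤ Real.log a :=
    Real.tendsto_log_atTop.eventually_ge_atTop _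
  have h2 : ∀ᶠ a : ℝ in atTop, Real.log a ≤ (1 / 4130) * a := by
    have := Real.isLittleO_log_id_atTop.def (show (0 : ℝ) < 1 / 4130 by norm_num)
    filter_upwards [this, eventually_ge_atTop 1] with a ha h1
    rw [Real.norm_of_nonneg (Real.log_nonneg h1)] at ha
    simpa [abs_of_nonneg (zero_le_one.trans h1)] using ha
  have h3 : ∀ᶠ a : ℝ in atTop, a ≤ Real.exp (a / 6) := by
    have h := Real.isLittleO_log_id_atTop.def (show (0 : ℝ) < 1 / 6 by norm_num)
    filter_upwards [h, eventually_ge_atTop 1] with a ha h1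
    rw [Real.norm_of_nonneg (Real.log_nonneg h1)] at ha
    rw [← Real.log_le_iff_le_exp (by linarith)]
    have : Real.log a ≤ 1 / 6 * a := by simpa [abs_of_nonneg (zero_le_one.trans h1)] using ha
    linarith
  filter_upwards [h1, h2, h3, eventually_ge_atTop 20] with a h1 h2 h3 h4
  have hl36 : 0 < Real.log 36 := Real.log_pos (by norm_num)
  have hb : 0 < Real.log a := by linarith
  refine ⟨by linarith, by rw [le_div_iff₀ hb]; linarith, ?_, h4⟩
  have e1 : (36 : ℝ) ^ (a / Real.log a) ≤ Real.exp (a / 6) := by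
    rw [Real.rpow_def_of_pos (by norm_num)]
    apply Real.exp_le_exp.2
    rw [mul_div_assoc', div_le_iff₀ hb]
    nlinarith
  have e2 : a / Real.log a ≤ Real.exp (a / 6) :=
    (div_le_self (by linarith) (by linarith)).trans h3
  calc (36 : ℝ) ^ (a / Real.log a) * (a / Real.log a) * Real.exp (a / 3)
      ≤ Real.exp (a / 6) * Real.exp (a / 6) * Real.exp (a / 3) := by
        have : 0 ≤ a / Real.log a := by positivity
        gcongr
    _ = Real.exp (a * (2 / 3)) := by rw [← Real.exp_add, ← Real.exp_add]; ring_nf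
    _ ≤ Real.exp a := Real.exp_le_exp.2 (by linarith)

/-- From r ≥ 3 follows d ≤ 9r ≤ r³, so log d ≤ 3 log r. This is the source of the 3 in K ≈ 3 log n /
log d. -/
lemma exp_lt_pow {r K : ℕ} {d y L : ℝ} (hr : 3 ≤ r) (hd : 0 < d) (hrd : d / 4 < r + 1)
    (hy : Real.exp y = d) (hy0 : 0 < y) (hK : 3 * L / y < K) : Real.exp L < (r : ℝ) ^ K := by
  have hr' : (3 : ℝ) ≤ r := by exact_mod_cast hr
  have hcube : d ≤ (r : ℝ) ^ 3 := by
    have h1 : (9 : ℝ) * r ≤ (r : ℝ) ^ 2 * r := by gcongr; nlinarith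
    calc d ≤ 9 * r := by linarith
      _ ≤ (r : ℝ) ^ 3 := by linarith [pow_succ (r : ℝ) 2]
  have hlog : y ≤ 3 * Real.log r := by
    have := Real.log_le_log hd hcube
    rw [Real.log_pow, ← hy, Real.log_exp] at this
    exact_mod_cast this
  have hKL : L < K * Real.log r := by
    rw [div_lt_iff₀ hy0] at hK
    have : (K : ℝ) * y ≤ K * (3 * Real.log r) := by gcongr
    linarith
  calc Real.exp L < Real.exp (K * Real.log r) := Real.exp_lt_exp.2 hKL
    _ = (r : ℝ) ^ K := by rw [Real.exp_nat_mul, Real.exp_log (by linarith)]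

lemma segment_length {n K : ℕ} {L y : ℝ} (hL : 0 < L) (hy : 2 ≤ y) (hn : (n : ℝ) = Real.exp L)
    (hL' : 600 ≤ L) (hK : (12 * (K + 2) : ℝ) ≤ 48 * (L / y)) :
    (n : ℝ) * y / (96 * L) + 2 ≤ (n / (12 * (K + 2)) : ℕ) := by
  have hs1 : (n : ℝ) / (12 * (K + 2)) < (n / (12 * (K + 2)) : ℕ) + 1 := by
    have := Nat.lt_floor_add_one ((n : ℝ) / ((12 * (K + 2) : ℕ) : ℝ))
    rw [Nat.floor_div_natCast, Nat.floor_natCast] at this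
    exact_mod_cast this
  have hs2 : (n : ℝ) * y / (48 * L) ≤ n / (12 * (K + 2)) := by
    have : (n : ℝ) * y / (48 * L) = n / (48 * (L / y)) := by field_simp
    rw [this]
    gcongr
  have h1 : (n : ℝ) * y / (48 * L) = n * y / (96 * L) + n * y / (96 * L) := by
    field_simp; ring
  have h2 : 3 ≤ (n : ℝ) * y / (96 * L) := by
    rw [le_div_iff₀ (by positivity)]
    have h3 : L / 2 + 1 ≤ Real.exp (L / 2) := Real.add_one_le_exp _
    have h4 : (L / 2 + 1) * (L / 2 + 1) ≤ n := by
      rw [hn, show L = L / 2 + L / 2 by ring, Real.exp_add, ← show L = L / 2 + L / 2 by ring]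
      gcongr
    have h5 : (n : ℝ) * 2 ≤ n * y := by gcongr
    nlinarith
  linarith

/-- Parameters for `isHamiltonConnected_of_expands`, where `x = log log n / log log log n`,
`L = log n` and `y = log d`. -/
lemma exists_parameters {n : ℕ} {L x y d T : ℝ} (hn : (n : ℝ) = Real.exp L) (hx : 4130 ≤ x)
    (hd : 12 ≤ d) (hy : Real.exp y = d) (hbig : (36 : ℝ) ^ x * x * y ≤ L)
    (hT : T = n * x * y / (4130 * L)) :
    ∃ M r t K h s : ℕ, 3 ≤ r ∧ (4 * r : ℝ) ≤ d ∧ 1 ≤ M ∧ (M : ℝ) ≤ 4130 * T / d ∧ 1 ≤ t ∧ T ≤ t ∧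
      (16 * t : ℝ) ≤ d * M ∧ 15 * t + 23 * M + 9 ≤ n ∧ M < r ^ K ∧ 3 * h ≤ K + 5 ∧
      12 * (K + 2) * s ≤ n ∧ 16 * t + 2 ≤ h * (s - 2) ∧ 54 * 36 ^ h * t < n := by
  have hy2 : 2 ≤ y := by
    by_contra! hcon
    have h1 : Real.exp y < Real.exp 1 * Real.exp 1 := by
      rw [← Real.exp_add]; exact Real.exp_lt_exp.2 (by linarith)
    have h2 := Real.exp_one_lt_d9
    have h3 := Real.exp_pos 1
    nlinarith
  have h36 : (36 : ℝ) ≤ (36 : ℝ) ^ x := by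
    calc (36 : ℝ) = (36 : ℝ) ^ (1 : ℝ) := (Real.rpow_one _).symm
      _ ≤ _ := Real.rpow_le_rpow_of_exponent_le (by norm_num) (by linarith)
  have hxy : 36 * (x * y) ≤ L := by
    calc 36 * (x * y) ≤ (36 : ℝ) ^ x * (x * y) := by gcongr
      _ = (36 : ℝ) ^ x * x * y := by ring
      _ ≤ L := hbig
  have hyx : 8260 ≤ x * y := by nlinarith
  have hLy : y * 4130 ≤ x * y := by nlinarith
  have hL : 0 < L := by linarith
  have hn0 : (0 : ℝ) < n := by rw [hn]; exact Real.exp_pos _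
  have hexp2 : L / 2 + 1 ≤ Real.exp (L / 2) := Real.add_one_le_exp _
  have hnsq : (n : ℝ) = Real.exp (L / 2) * Real.exp (L / 2) := by
    rw [hn, ← Real.exp_add]; ring_nf
  have hdn : d ≤ Real.exp (L / 2) := by rw [← hy]; exact Real.exp_le_exp.2 (by linarith)
  have hTn : n ≤ T * L := by
    rw [hT, div_mul_eq_mul_div, le_div_iff₀ (by positivity)]
    have : (n : ℝ) * (4130 * L) ≤ (n : ℝ) * ((x * y) * L) := by gcongr; linarith
    linarith
  have hTd : 2 * d ≤ 4 * T := by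
    have h1 : d * (L / 2) ≤ n := by
      rw [hnsq]
      exact mul_le_mul hdn (by linarith) (by positivity) (by positivity)
    have h2 : d * (L / 2) ≤ T * L := h1.trans hTn
    have h3 : (d / 2) * L ≤ T * L := by linarith
    have := le_of_mul_le_mul_right h3 hL
    linarith
  have hT6 : 6 ≤ T := by linarith
  have hTup : 4130 * T * 36 ≤ n := by
    have : 4130 * T * 36 = n * (36 * (x * y)) / L := by rw [hT]; field_simp
    rw [this, div_le_iff₀ hL]
    gcongr
  -- T is the threshold of P2 and 4130 T / d that of P1. K makes r^K exceed n, and s is the longest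
  -- segment length allowed by 12(K + 2)s ≤ n.
  obtain ⟨M, hM⟩ : ∃ M, M = ⌊4130 * T / d⌋₊ := ⟨_, rfl⟩
  obtain ⟨t, ht⟩ : ∃ t, t = ⌈T⌉₊ := ⟨_, rfl⟩
  obtain ⟨r, hr⟩ : ∃ r, r = ⌊d / 4⌋₊ := ⟨_, rfl⟩
  obtain ⟨K, hK⟩ : ∃ K, K = ⌊3 * L / y⌋₊ + 1 := ⟨_, rfl⟩
  obtain ⟨h, hh⟩ : ∃ h, h = ⌈x⌉₊ := ⟨_, rfl⟩
  obtain ⟨s, hs⟩ : ∃ s, s = n / (12 * (K + 2)) := ⟨_, rfl⟩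
  have hd0 : 0 < d := by linarith
  have hM1 : (M : ℝ) ≤ 4130 * T / d := by rw [hM]; exact Nat.floor_le (by positivity)
  have hM2 : 4130 * T / d < M + 1 := by rw [hM]; exact Nat.lt_floor_add_one _
  have ht1 : T ≤ t := by rw [ht]; exact Nat.le_ceil _
  have ht2 : (t : ℝ) < T + 1 := by rw [ht]; exact Nat.ceil_lt_add_one (by linarith)
  have hr1 : (r : ℝ) ≤ d / 4 := by rw [hr]; exact Nat.floor_le (by positivity)
  have hr2 : d / 4 < r + 1 := by rw [hr]; exact Nat.lt_floor_add_one _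
  have hr3 : 3 ≤ r := by rw [hr]; exact Nat.le_floor (by norm_num; linarith)
  have hy0 : 0 < y := by linarith
  have hK1 : (K : ℝ) ≤ 3 * L / y + 1 := by
    rw [hK]; push_cast; gcongr; exact Nat.floor_le (by positivity)
  have hK2 : 3 * L / y < K := by rw [hK]; push_cast; exact Nat.lt_floor_add_one _
  have hh1 : x ≤ h := by rw [hh]; exact Nat.le_ceil _
  have hh2 : (h : ℝ) < x + 1 := by rw [hh]; exact Nat.ceil_lt_add_one (by linarith)
  have hdM : 4130 * T - d < d * M := by
    rw [div_lt_iff₀ hd0] at hM2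
    linarith
  have hMn : 12 * (M : ℝ) ≤ 4130 * T := by
    rw [le_div_iff₀ hd0] at hM1
    have : (M : ℝ) * 12 ≤ M * d := by gcongr
    linarith
  have hxL : x + 1 ≤ L / y := by
    rw [le_div_iff₀ hy0]
    nlinarith
  refine ⟨M, r, t, K, h, s, hr3, by linarith, ?_, hM1, ?_, ht1, by linarith, ?_, ?_, ?_, ?_, ?_, ?_⟩
  · rw [hM]
    apply Nat.le_floor
    rw [Nat.cast_one, le_div_iff₀ hd0]
    linarith
  · have : (1 : ℝ) ≤ t := by linarith
    exact_mod_cast this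
  · have : (15 * t + 23 * M + 9 : ℝ) ≤ n := by linarith
    exact_mod_cast this
  · have h1 : (M : ℝ) < r ^ K :=
      lt_of_le_of_lt (by linarith) (hn ▸ exp_lt_pow hr3 hd0 (by linarith) hy hy0 hK2)
    exact_mod_cast h1
  · have : (3 * h : ℝ) ≤ K + 5 := by
      have : 3 * L / y = 3 * (L / y) := by ring
      linarith
    exact_mod_cast this
  · rw [hs]
    exact Nat.mul_div_le _ _
  · have hs4 : (n : ℝ) * y / (96 * L) + 2 ≤ s := by
      rw [hs]
      refine segment_length hL hy2 hn ?_ ?_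
      · linarith
      · have : 3 * L / y = 3 * (L / y) := by ring
        linarith
    have hs5 : 2 ≤ s := by
      have : (2 : ℝ) ≤ s := by
        have : (0 : ℝ) ≤ n * y / (96 * L) := by positivity
        linarith
      exact_mod_cast this
    -- This is one use of the constant 4130: 4130/96 exceeds 43, and 43T ≥ 16t + 2 because t < T + 1
    -- and T ≥ 6.
    have h43 : 43 * T ≤ x * (n * y / (96 * L)) := by
      have : x * (n * y / (96 * L)) = 4130 / 96 * T := by rw [hT]; field_simp
      rw [this]
      linarith
    have : (16 * t + 2 : ℝ) ≤ h * (s - 2) := by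
      have h1 : x * (n * y / (96 * L)) ≤ h * (s - 2) := by
        apply mul_le_mul hh1 (by linarith) (by positivity) (by positivity)
      linarith
    have h2 : ((16 * t + 2 : ℕ) : ℝ) ≤ ((h * (s - 2) : ℕ) : ℝ) := by
      push_cast [Nat.cast_sub hs5]
      exact this
    exact_mod_cast h2
  · have h1 : (36 : ℝ) ^ h ≤ 36 * (36 : ℝ) ^ x := by
      rw [← Real.rpow_natCast]
      calc (36 : ℝ) ^ (h : ℝ) ≤ (36 : ℝ) ^ (x + 1) :=
            Real.rpow_le_rpow_of_exponent_le (by norm_num) hh2.le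
        _ = _ := by rw [Real.rpow_add (by norm_num), Real.rpow_one, mul_comm]
    have h2 : (36 : ℝ) ^ x * T ≤ n / 4130 := by
      have : (36 : ℝ) ^ x * T = (n / 4130) * (((36 : ℝ) ^ x * x * y) / L) := by
        rw [hT]; field_simp
      rw [this]
      exact mul_le_of_le_one_right (by positivity) ((div_le_one hL).2 hbig)
    have h3 : (54 * 36 ^ h * t : ℝ) < n := by
      -- Rounding x up to h costs a factor 36 and rounding T up to t a factor 2. The total 54 · 36 ·
      -- 2 = 3888 is still below 4130.
      calc (54 * 36 ^ h * t : ℝ) ≤ 54 * (36 * (36 : ℝ) ^ x) * (2 * T) := by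
            gcongr
            linarith
        _ = 3888 * ((36 : ℝ) ^ x * T) := by ring
        _ ≤ 3888 * (n / 4130) := by gcongr
        _ < n := by linarith
    exact_mod_cast h3

end SimpleGraph

/-! ### The main theorem. -/

open SimpleGraph Filter in
theorem theorem3 :
    ∃ n₀ : ℕ, ∀ (V : Type*) [Fintype V] [DecidableEq V] (G : SimpleGraph V) (d : ℝ),
      n₀ ≤ Fintype.card V →
      12 ≤ d →
      d ≤ Real.exp (Real.log (Fintype.card V : ℝ) ^ (1 / 3 : ℝ)) →
      G.PropertyP1 d →
      G.PropertyP2 d →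
        G.IsHamiltonConnected ∧
        ∀ e ∈ G.edgeSet, ∃ (a : V) (p : G.Walk a a), p.IsHamiltonianCycle ∧ e ∈ p.edges := by
  have hev : ∀ᶠ n : ℕ in atTop, _ :=
    (Real.tendsto_log_atTop.comp (Real.tendsto_log_atTop.comp
      tendsto_natCast_atTop_atTop)).eventually eventually_log_bounds
  obtain ⟨n₀, hn₀⟩ := eventually_atTop.1 hev
  refine ⟨max n₀ 3, fun V _ _ G d hV hd hd' hP1 hP2 => ?_⟩
  obtain ⟨hb, hx, hbig, ha⟩ := hn₀ (Fintype.card V) ((le_max_left _ _).trans hV)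
  have hV3 : 3 ≤ Fintype.card V := (le_max_right _ _).trans hV
  unfold PropertyP1 at hP1
  unfold PropertyP2 at hP2
  dsimp only at hP1 hP2
  simp only [Function.comp_apply] at hb hx hbig ha
  set L := Real.log (Fintype.card V : ℝ) with hL
  have hL0 : 0 < L := Real.log_pos (by exact_mod_cast (show 1 < Fintype.card V by omega))
  have hn0 : (0 : ℝ) < Fintype.card V := by positivity
  have hn : (Fintype.card V : ℝ) = Real.exp L := (Real.exp_log hn0).symm
  -- With L = log n, the cube root of L is exp((log L)/3), the form used in `eventually_log_bounds`.
  have hy : Real.log d ≤ Real.exp (Real.log L / 3) := by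
    have h1 := Real.log_le_log (by linarith) hd'
    rw [Real.log_exp, Real.rpow_def_of_pos hL0] at h1
    convert h1 using 2
    ring
  set a := Real.log L with ha'
  set b := Real.log a with hb'
  have hLa : Real.exp a = L := Real.exp_log hL0
  rw [hLa] at hbig
  have hb0 : 0 < b := by linarith
  obtain ⟨M, r, t, K, h, s, hr3, hr, hM, hMle, ht, htle, hMt, hcard, hK, hh, hs, hst, hbig'⟩ :=
    exists_parameters (T := Fintype.card V * (a / b) * Real.log d / (4130 * L)) hn hx hd
      (Real.exp_log (by linarith)) (le_trans (by gcongr) hbig) rfl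
  have hham : G.IsHamiltonConnected := by
    refine isHamiltonConnected_of_expands hd hr3 hr ?_ ?_ hM ht hMt hcard hK hh hs hst hbig'
    · intro S hS
      refine hP1 S (le_trans (by exact_mod_cast hS) (hMle.trans (le_of_eq ?_)))
      field_simp
    · have heq : (Fintype.card V : ℝ) * a * Real.log d / (4130 * L * b)
          = Fintype.card V * (a / b) * Real.log d / (4130 * L) := by field_simp
      intro A B hAB hA hB
      refine hP2 A B hAB ?_ ?_
      · rw [heq]; exact htle.trans (by exact_mod_cast hA)
      · rw [heq]; exact htle.trans (by exact_mod_cast hB)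
  refine ⟨hham, fun e he => ?_⟩
  induction e using Sym2.ind with
  | _ x y =>
    obtain ⟨p, hp⟩ := hham y x (G.ne_of_adj he).symm
    exact ⟨x, Walk.cons (G.mem_edgeSet.1 he) p, hp.exists_isHamiltonianCycle_cons _ hV3, by simp⟩
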